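/- Let $H_1=\mathbb R^3$ be the Heisenberg group with contact form $\Theta=dz+x\,dy-y\,dx$, contact planes $\xi=\ker\Theta$, left-invariant frame $\mathring e_1=\partial_x+y\,\partial_z$, $\mathring e_2=\partial_y-x\,\partial_z$, $T=\partial_z$, the CR structure $J\mathring e_1=\mathring e_2$, $J\mathring e_2=-\mathring e_1$ on $\xi$, the metric for which this frame is orthonormal, and the connection $\nabla$ for which it is parallel. Let $\Sigma\subset H_1$ be an embedded surface of class $C^2$. A point $p\in\Sigma$ is singular if $T_p\Sigma=\xi_p$ and regular otherwise; assume that $\Sigma$ is $C^\infty$ on its regular part. Assume that $\Sigma$ has constant $p$-mean curvature $H=c\neq0$: on the regular part there is a smooth unit vector field $e_1$ spanning $T\Sigma\cap\xi$ such that $\nabla_{e_1}(Je_1)=-c\,e_1$. The leaves of the characteristic foliation are the maximal integral curves of $e_1$ in the regular part. Let $\Gamma\subset\Sigma$ be a singular curve (a curve all of whose points are singular; no differentiability of it is assumed, but each of its points is an interior point of an arc in it), and let $p_0\in\Gamma$. Then: 1. There is a neighbourhood $U$ of $p_0$ such that each leaf that meets $U$ extends smoothly, at an end of its (at that end finite)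 interval of definition, to a point of $\Gamma$. 2. There are leaves that arrive at $p_0$ from both sides of $\Gamma$ in $\Sigma$. Any two leaves that arrive at $p_0$ from opposite sides of $\Gamma$ form, together with $p_0$, a regular curve of class $C^1$. This curve is of class $C^\infty$ if $e_1$ is directed consistently along it (towards $p_0$ on one of the two leaves and away from $p_0$ on the other). It is also of class $C^\infty$ whenever $\Sigma$ is of class $C^3$ near $p_0$. -/

import Mathlib

open Set Filter Topology
open scoped ContDiff

/-- The underlying space `ℝ³` of the Heisenberg group `H₁`, with coordinates
`x = p 0`, `y = p 1`, `z = p 2`. Tangent vectors are written in the basis `∂x, ∂y, ∂z`. -/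
abbrev H1 : Type := Fin 3 → ℝ

/-- The left invariant field `∂x + y ∂z`. -/
def frameX (p : H1) : H1 := ![1, 0, p 1]

/-- The left invariant field `∂y - x ∂z`. -/
def frameY (p : H1) : H1 := ![0, 1, -p 0]

/-- The left invariant field `T = ∂z`. -/
def frameT (_p : H1) : H1 := ![0, 0, 1]

/-- The contact form `Θ = dz + x dy - y dx`. -/
def contactForm (p v : H1) : ℝ := v 2 + p 0 * v 1 - p 1 * v 0

/-- The contact plane `ξ_p = ker Θ_p`. -/
def contactPlane (p : H1) : Set H1 := {v | contactForm p v = 0}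

/-- The coordinates of the tangent vector `v` at `p` in the frame `frameX, frameY, frameT`. -/
def frameCoord (p v : H1) : Fin 3 → ℝ := ![v 0, v 1, contactForm p v]

theorem frameCoord_spec (p v : H1) :
    v = frameCoord p v 0 • frameX p + frameCoord p v 1 • frameY p
      + frameCoord p v 2 • frameT p := by
  funext i
  fin_cases i <;> simp [frameCoord, frameX, frameY, frameT, contactForm]
  ring

/-- The adapted metric, for which `frameX, frameY, frameT` are orthonormal. -/
def adaptedMetric (p v w : H1) : ℝ := ∑ i, frameCoord p v i * frameCoord p w i

/-- The CR structure: `J frameX = frameY`, `J frameY = -frameX`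
(only used on vectors of the contact plane). -/
def crJ (p v : H1) : H1 := v 0 • frameY p - v 1 • frameX p

/-- `∇_{γ'} V = W` at the time `t`, where `V` is a vector field along the curve `γ` and `∇` is the
connection for which `frameX, frameY, frameT` are parallel. -/
def HasCovDerivAt (γ V : ℝ → H1) (W : H1) (t : ℝ) : Prop :=
  HasDerivAt (fun s => frameCoord (γ s) (V s)) (frameCoord (γ t) W) t

/-- Near `p`, the set `S` is an embedded surface of class `C^n`. -/
def IsSurfaceAt (n : WithTop ℕ∞) (S : Set H1) (p : H1) : Prop :=
  ∃ (U : Set H1) (f : H1 → ℝ), IsOpen U ∧ p ∈ U ∧ ContDiffOn ℝ n f U ∧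
    (∀ q ∈ U, fderiv ℝ f q ≠ 0) ∧ ∀ q ∈ U, q ∈ S ↔ f q = 0

/-- The tangent plane `T_p S`, as the set of velocities of curves in `S` through `p`. -/
def tangentPlane (S : Set H1) (p : H1) : Set H1 :=
  {v | ∃ γ : ℝ → H1, γ 0 = p ∧ (∀ᶠ t in 𝓝 0, γ t ∈ S) ∧ HasDerivAt γ v 0}

/-- The singular points: the tangent plane coincides with the contact plane. -/
def singularSet (S : Set H1) : Set H1 := {p ∈ S | tangentPlane S p = contactPlane p}

def regularPart (S : Set H1) : Set H1 := S \ singularSet S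

/-- A surface in `H₁`, of class `C²`, and of class `C^∞` on its regular part. -/
structure IsHeisenbergSurface (S : Set H1) : Prop where
  c2 : ∀ p ∈ S, IsSurfaceAt 2 S p
  smooth : ∀ p ∈ regularPart S, IsSurfaceAt ∞ S p

/-- `e₁` is a smooth unit vector field on the regular part of `S` that spans the intersection of
the tangent plane with the contact plane. (Values of `e₁` elsewhere play no role.) -/
structure IsCharacteristicField (S : Set H1) (e₁ : H1 → H1) : Prop where
  smooth : ∀ p ∈ regularPart S, ∃ (U : Set H1) (E : H1 → H1), IsOpen U ∧ p ∈ U ∧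
    ContDiffOn ℝ ∞ E U ∧ EqOn E e₁ (regularPart S ∩ U)
  tangent : ∀ p ∈ regularPart S, e₁ p ∈ tangentPlane S p ∩ contactPlane p
  unit : ∀ p ∈ regularPart S, adaptedMetric p (e₁ p) (e₁ p) = 1

/-- The `p`-mean curvature at `p`, with respect to `e₁`, is `H`: with `e₂ = J e₁`, one has
`∇_{e₁} e₂ = -H e₁` at `p`, the derivative being taken along curves in `S` with velocity
`e₁ p` at `p`. -/
def HasPMeanCurvatureAt (S : Set H1) (e₁ : H1 → H1) (H : ℝ) (p : H1) : Prop :=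
  ∀ γ : ℝ → H1, γ 0 = p → (∀ᶠ t in 𝓝 0, γ t ∈ S) → HasDerivAt γ (e₁ p) 0 →
    HasCovDerivAt γ (fun t => crJ (γ t) (e₁ (γ t))) (-(H • e₁ p)) 0

/-- `S` is a surface of constant `p`-mean curvature `c`, where `e₁` is the choice of the
characteristic direction (a priori determined up to sign) for which the curvature is `c`. -/
structure IsConstantPMeanCurvatureSurface (S : Set H1) (e₁ : H1 → H1) (c : ℝ) : Prop where
  surface : IsHeisenbergSurface S
  field : IsCharacteristicField S e₁
  curvature : ∀ p ∈ regularPart S, HasPMeanCurvatureAt S e₁ c p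

/-- On the interval `I`, `γ` is an integral curve of `e₁` in the regular part of `S`. -/
def IsCharacteristicCurve (S : Set H1) (e₁ : H1 → H1) (I : Set ℝ) (γ : ℝ → H1) : Prop :=
  ∀ t ∈ I, γ t ∈ regularPart S ∧ HasDerivAt γ (e₁ (γ t)) t

/-- A leaf of the characteristic foliation: a maximal integral curve `γ` of `e₁`, defined on the
open interval `I` (the values of `γ` outside `I` play no role). -/
structure IsLeaf (S : Set H1) (e₁ : H1 → H1) (I : Set ℝ) (γ : ℝ → H1) : Prop where
  isOpen : IsOpen I
  ordConnected : I.OrdConnected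
  nonempty : I.Nonempty
  curve : IsCharacteristicCurve S e₁ I γ
  maximal : ∀ (J : Set ℝ) (η : ℝ → H1), IsOpen J → J.OrdConnected →
    IsCharacteristicCurve S e₁ J η → I ⊆ J → EqOn η γ I → J = I

/-- A curve of singular points: through each point of `Γ` there passes, as an interior point, an
arc in `Γ`. No differentiability of the curve is assumed. -/
structure IsSingularCurve (S Γ : Set H1) : Prop where
  subset : Γ ⊆ singularSet S
  arc : ∀ p ∈ Γ, ∃ η : ℝ → H1, η 0 = p ∧ ContinuousOn η (Ioo (-1) 1) ∧
    InjOn η (Ioo (-1) 1) ∧ MapsTo η (Ioo (-1) 1) Γ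

/-- A piece of a leaf with end point `p`, parametrized by the distance `t ∈ [0, ε)` from `p` along
the leaf. If `σ = 1`, the field `e₁` points away from `p` along it; if `σ = -1`, it points
towards `p`. -/
structure IsLeafArc (S : Set H1) (e₁ : H1 → H1) (p : H1) (σ ε : ℝ) (γ : ℝ → H1) : Prop where
  pos : 0 < ε
  sign : σ = 1 ∨ σ = -1
  start : γ 0 = p
  continuousOn : ContinuousOn γ (Ico 0 ε)
  regular : ∀ t ∈ Ioo 0 ε, γ t ∈ regularPart S
  deriv : ∀ t ∈ Ioo 0 ε, HasDerivAt γ (σ • e₁ (γ t)) t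

/-- The two arcs leave `p` into different sides of `Γ` in `S`: in some neighbourhood `U` of `p`,
they run in different connected components of the complement of `Γ`. -/
def OnOppositeSides (S Γ : Set H1) (p : H1) (γ₁ γ₂ : ℝ → H1) : Prop :=
  ∃ U ∈ 𝓝 p, ∀ᶠ t in 𝓝[>] (0 : ℝ), connectedComponentIn ((S ∩ U) \ Γ) (γ₁ t) ≠
    connectedComponentIn ((S ∩ U) \ Γ) (γ₂ t)

/-- The union of two arcs with the same initial point, as one curve: `γ₁` backwards up to the
time `0`, and then `γ₂`. -/
noncomputable def joinArcs (γ₁ γ₂ : ℝ → H1) (t : ℝ) : H1 :=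
  if t ≤ 0 then γ₁ (-t) else γ₂ t

/-!
The leaves of a surface of constant `p`-mean curvature `c ≠ 0` are explicit: the curvature equation
says that the planar velocity of a leaf turns at the rate `c`, so that a leaf is a helix, the
horizontal lift of an arc of a circle of radius `1 / |c|`
(`IsConstantPMeanCurvatureSurface.eq_helix`). In particular a leaf is smooth up to and beyond the
ends of its interval of definition, and what remains is to see how leaves meet the singular curve.

Write the surface near `p₀` as `{f = 0}`, and let `A = Xf` and `B = Yf` be the derivatives along
the left invariant frame. The singular points are the common zeros of `A` and `B`, and the
characteristic direction is `(B, -A) / |(A, B)|`. Since `[X, Y] = -2 T`, one has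
`XB - YA = -2 Tf ≠ 0` at `p₀`, so one of `A` and `B` is a defining function `α` of a `C¹` curve in
the surface. This curve contains `Γ` near `p₀`, and an injective arc in `Γ` fills it, by the
intermediate value theorem (`eventually_mem_of_arc`). Both `A` and `B` vanish on the curve, so
`A / α` and `B / α` have limits at `p₀` (`exists_tendsto_div`). Hence the characteristic direction
has limits `m` and `-m` at `p₀` from the two sides, and the commutator identity shows that `m` is
transverse to `Γ` (`exists_twoSidedModel`).

On either side, `α` therefore changes along leaves at a rate bounded away from `0`. In one direction
a leaf reaches `Γ` after a short time, because it cannot end at a regular point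
(`IsSideModel.exists_leaf_end`); in the other direction it can be followed for a uniform time, so
that leaves through points converging to `p₀` converge to a leaf that starts at `p₀`
(`IsSideModel.exists_isLeafArc`). Every leaf that arrives at `p₀` has the direction `m` or `-m`
there, depending on the side (`IsSideModel.eq_helix_of_isLeafArc`), so leaves from opposite sides
join to a regular `C¹` curve. If `e₁` is directed consistently along it, both pieces belong to the
same helix. Otherwise `e₁` points away from `p₀` on both pieces, or towards `p₀` on both, and the
curvature of the joined curve changes its sign at `p₀`; on a surface of class `C³` this is
impossible, because the third derivative of `f` vanishes along both pieces, and this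
determines the curvature at `p₀` (`IsTwoSidedModel.not_both_away`).
-/

/-! ### Helices: the horizontal curves over circles -/

/-- The vector of the contact plane at `p` over the planar vector `v`, that is
`v.1 • frameX p + v.2 • frameY p`. -/
def planarLift (p : H1) (v : ℝ × ℝ) : H1 := ![v.1, v.2, p 1 * v.1 - p 0 * v.2]

/-- The planar vector `v` rotated by the angle `k * t`. -/
noncomputable def rot (k : ℝ) (v : ℝ × ℝ) (t : ℝ) : ℝ × ℝ :=
  (v.1 * Real.cos (k * t) - v.2 * Real.sin (k * t),
    v.1 * Real.sin (k * t) + v.2 * Real.cos (k * t))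

/-- The horizontal curve from `p` with planar initial velocity `v` whose projection to the
`xy`-plane turns at the constant rate `k`; the formula is meant for `k ≠ 0`. -/
noncomputable def helix (k : ℝ) (p : H1) (v : ℝ × ℝ) (t : ℝ) : H1 :=
  ![p 0 + (v.1 * Real.sin (k * t) + v.2 * (Real.cos (k * t) - 1)) / k,
    p 1 + (v.1 * (1 - Real.cos (k * t)) + v.2 * Real.sin (k * t)) / k,
    p 2 + p 1 * ((v.1 * Real.sin (k * t) + v.2 * (Real.cos (k * t) - 1)) / k)
      - p 0 * ((v.1 * (1 - Real.cos (k * t)) + v.2 * Real.sin (k * t)) / k)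
      + (v.1 ^ 2 + v.2 ^ 2) * (Real.sin (k * t) / k - t) / k]

@[simp] theorem rot_zero (k : ℝ) (v : ℝ × ℝ) : rot k v 0 = v := by simp [rot]

@[simp] theorem helix_zero (k : ℝ) (p : H1) (v : ℝ × ℝ) : helix k p v 0 = p := by
  funext i
  fin_cases i <;> simp [helix]

theorem planarLift_injective (p : H1) : Function.Injective (planarLift p) := by
  intro v w h
  exact Prod.ext (by simpa [planarLift] using congrFun h 0)
    (by simpa [planarLift] using congrFun h 1)

theorem planarLift_smul (p : H1) (σ : ℝ) (v : ℝ × ℝ) :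
    planarLift p (σ • v) = σ • planarLift p v := by
  funext i
  fin_cases i <;> simp [planarLift]
  ring

theorem planarLift_neg (p : H1) (v : ℝ × ℝ) : planarLift p (-v) = -planarLift p v := by
  simpa using planarLift_smul p (-1) v

theorem planarLift_eq_of_mem_contactPlane {p v : H1} (h : v ∈ contactPlane p) :
    planarLift p (v 0, v 1) = v := by
  have h' : v 2 + p 0 * v 1 - p 1 * v 0 = 0 := h
  funext i
  fin_cases i <;> simp [planarLift]
  linarith

theorem contDiff_planarLift {n : WithTop ℕ∞} :
    ContDiff ℝ n (fun q : H1 × (ℝ × ℝ) => planarLift q.1 q.2) := by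
  refine contDiff_pi.2 fun i => ?_
  fin_cases i <;> simp [planarLift] <;> fun_prop

theorem rot_neg_vec (k : ℝ) (v : ℝ × ℝ) (t : ℝ) : rot k (-v) t = -rot k v t := by
  simp only [rot]
  ext <;> simp <;> ring

theorem rot_neg_neg (k : ℝ) (v : ℝ × ℝ) (t : ℝ) : rot (-k) v (-t) = rot k v t := by
  simp [rot]

theorem helix_neg_neg (k : ℝ) (p : H1) (v : ℝ × ℝ) (t : ℝ) :
    helix k p (-v) (-t) = helix (-k) p v t := by
  funext i
  fin_cases i <;> simp [helix] <;> ring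

theorem hasDerivAt_rot_fst (k : ℝ) (v : ℝ × ℝ) (t : ℝ) :
    HasDerivAt (fun s => (rot k v s).1) (-k * (rot k v t).2) t := by
  have h1 : HasDerivAt (fun s => k * s) k t := by simpa using (hasDerivAt_id t).const_mul k
  refine ((h1.cos.const_mul v.1).sub (h1.sin.const_mul v.2)).congr_deriv ?_
  simp only [rot]
  ring

theorem hasDerivAt_rot_snd (k : ℝ) (v : ℝ × ℝ) (t : ℝ) :
    HasDerivAt (fun s => (rot k v s).2) (k * (rot k v t).1) t := by
  have h1 : HasDerivAt (fun s => k * s) k t := by simpa using (hasDerivAt_id t).const_mul k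
  refine ((h1.sin.const_mul v.1).add (h1.cos.const_mul v.2)).congr_deriv ?_
  simp only [rot]
  ring

theorem continuous_rot (k : ℝ) (v : ℝ × ℝ) : Continuous (rot k v) := by
  unfold rot
  fun_prop

theorem contDiff_helix (k : ℝ) (p : H1) (v : ℝ × ℝ) {n : WithTop ℕ∞} :
    ContDiff ℝ n (helix k p v) := by
  refine contDiff_pi.2 fun i => ?_
  fin_cases i <;> simp [helix] <;> fun_prop

theorem continuous_helix_uncurry (k : ℝ) :
    Continuous (fun q : (H1 × ℝ) × (ℝ × ℝ) => helix k q.1.1 q.2 q.1.2) := by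
  refine continuous_pi fun i => ?_
  fin_cases i <;> simp [helix] <;> fun_prop

theorem hasDerivAt_helix {k : ℝ} (hk : k ≠ 0) (p : H1) (v : ℝ × ℝ) (t : ℝ) :
    HasDerivAt (helix k p v) (planarLift (helix k p v t) (rot k v t)) t := by
  have h1 : HasDerivAt (fun s => k * s) k t := by simpa using (hasDerivAt_id t).const_mul k
  have hx : HasDerivAt (fun s => (v.1 * Real.sin (k * s) + v.2 * (Real.cos (k * s) - 1)) / k)
      (rot k v t).1 t := by
    refine (((h1.sin.const_mul v.1).add
      ((h1.cos.sub_const 1).const_mul v.2)).div_const k).congr_deriv ?_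
    simp only [rot]
    field_simp
    ring
  have hy : HasDerivAt (fun s => (v.1 * (1 - Real.cos (k * s)) + v.2 * Real.sin (k * s)) / k)
      (rot k v t).2 t := by
    refine ((((h1.cos.const_sub 1).const_mul v.1).add
      (h1.sin.const_mul v.2)).div_const k).congr_deriv ?_
    simp only [rot]
    field_simp
  have hz : HasDerivAt (fun s => (v.1 ^ 2 + v.2 ^ 2) * (Real.sin (k * s) / k - s) / k)
      ((v.1 ^ 2 + v.2 ^ 2) * (Real.cos (k * t) - 1) / k) t := by
    refine ((((h1.sin.div_const k).sub (hasDerivAt_id t)).const_mul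
      (v.1 ^ 2 + v.2 ^ 2)).div_const k).congr_deriv ?_
    field_simp
  refine hasDerivAt_pi.2 fun i => ?_
  fin_cases i
  · simpa [helix, planarLift] using hx.const_add (p 0)
  · simpa [helix, planarLift] using hy.const_add (p 1)
  · have := (((hx.const_mul (p 1)).const_add (p 2)).sub (hy.const_mul (p 0))).add hz
    simp only [helix, planarLift]
    refine this.congr_deriv ?_
    simp [rot]
    field_simp
    linear_combination (v.1 ^ 2 + v.2 ^ 2) * Real.sin_sq_add_cos_sq (k * t)

/-- The only horizontal curves whose planar velocity turns at the constant rate `k` are the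
helices. -/
theorem eq_helix_of_hasDerivAt {k : ℝ} (hk : k ≠ 0) {I : Set ℝ} (hI : IsOpen I)
    (hI' : IsPreconnected I) {η : ℝ → H1} {v : ℝ → ℝ × ℝ}
    (hη : ∀ t ∈ I, HasDerivAt η (planarLift (η t) (v t)) t)
    (h1 : ∀ t ∈ I, HasDerivAt (fun s => (v s).1) (-k * (v t).2) t)
    (h2 : ∀ t ∈ I, HasDerivAt (fun s => (v s).2) (k * (v t).1) t)
    {t₀ t : ℝ} (ht₀ : t₀ ∈ I) (ht : t ∈ I) :
    η t = helix k (η t₀) (v t₀) (t - t₀) ∧ v t = rot k (v t₀) (t - t₀) := by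
  have const : ∀ g : ℝ → ℝ, (∀ s ∈ I, HasDerivAt g 0 s) → ∀ s ∈ I, g s = g t₀ :=
    fun g hg s hs => hI.is_const_of_deriv_eq_zero hI'
      (fun r hr => (hg r hr).differentiableAt.differentiableWithinAt)
      (fun r hr => (hg r hr).deriv) hs ht₀
  have hl : ∀ s, HasDerivAt (fun s => k * (s - t₀)) k s := fun s => by
    simpa using ((hasDerivAt_id s).sub_const t₀).const_mul k
  -- the velocity, rotated back, is constant
  have c1 := const (fun s => (v s).1 * Real.cos (k * (s - t₀)) + (v s).2 * Real.sin (k * (s - t₀)))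
    (fun s hs => by
      refine (((h1 s hs).mul (hl s).cos).add ((h2 s hs).mul (hl s).sin)).congr_deriv ?_
      ring)
  have c2 := const (fun s => (v s).2 * Real.cos (k * (s - t₀)) - (v s).1 * Real.sin (k * (s - t₀)))
    (fun s hs => by
      refine (((h2 s hs).mul (hl s).cos).sub ((h1 s hs).mul (hl s).sin)).congr_deriv ?_
      ring)
  have hv : ∀ s ∈ I, v s = rot k (v t₀) (s - t₀) := by
    intro s hs
    have e1 := c1 s hs
    have e2 := c2 s hs
    simp only [sub_self, mul_zero, Real.cos_zero, Real.sin_zero, mul_one, add_zero, sub_zero]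
      at e1 e2
    have hsc := Real.sin_sq_add_cos_sq (k * (s - t₀))
    refine Prod.ext ?_ ?_ <;> simp only [rot]
    · linear_combination Real.cos (k * (s - t₀)) * e1 - Real.sin (k * (s - t₀)) * e2
        - (v s).1 * hsc
    · linear_combination Real.sin (k * (s - t₀)) * e1 + Real.cos (k * (s - t₀)) * e2
        - (v s).2 * hsc
  refine ⟨?_, hv t ht⟩
  have hG : ∀ s, HasDerivAt (fun s => helix k (η t₀) (v t₀) (s - t₀))
      (planarLift (helix k (η t₀) (v t₀) (s - t₀)) (rot k (v t₀) (s - t₀))) s := fun s => by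
    simpa using (hasDerivAt_helix hk (η t₀) (v t₀) (s - t₀)).comp_sub_const s t₀
  have d0 : ∀ s ∈ I, η s 0 = helix k (η t₀) (v t₀) (s - t₀) 0 := by
    intro s hs
    have := const (fun s => η s 0 - helix k (η t₀) (v t₀) (s - t₀) 0) (fun r hr => by
      refine ((hasDerivAt_pi.1 (hη r hr) 0).sub (hasDerivAt_pi.1 (hG r) 0)).congr_deriv ?_
      simp [planarLift, hv r hr]) s hs
    simpa [sub_eq_zero] using this
  have d1 : ∀ s ∈ I, η s 1 = helix k (η t₀) (v t₀) (s - t₀) 1 := by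
    intro s hs
    have := const (fun s => η s 1 - helix k (η t₀) (v t₀) (s - t₀) 1) (fun r hr => by
      refine ((hasDerivAt_pi.1 (hη r hr) 1).sub (hasDerivAt_pi.1 (hG r) 1)).congr_deriv ?_
      simp [planarLift, hv r hr]) s hs
    simpa [sub_eq_zero] using this
  have d2 : ∀ s ∈ I, η s 2 = helix k (η t₀) (v t₀) (s - t₀) 2 := by
    intro s hs
    have := const (fun s => η s 2 - helix k (η t₀) (v t₀) (s - t₀) 2) (fun r hr => by
      refine ((hasDerivAt_pi.1 (hη r hr) 2).sub (hasDerivAt_pi.1 (hG r) 2)).congr_deriv ?_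
      simp [planarLift, hv r hr, d0 r hr, d1 r hr]) s hs
    simpa [sub_eq_zero] using this
  funext i
  fin_cases i
  exacts [d0 t ht, d1 t ht, d2 t ht]

/-- Helices restart as helices. -/
theorem helix_add {k : ℝ} (hk : k ≠ 0) (p : H1) (v : ℝ × ℝ) (s t : ℝ) :
    helix k p v (s + t) = helix k (helix k p v s) (rot k v s) t ∧
      rot k v (s + t) = rot k (rot k v s) t := by
  simpa using eq_helix_of_hasDerivAt hk isOpen_univ isPreconnected_univ
    (fun t _ => hasDerivAt_helix hk p v t) (fun t _ => hasDerivAt_rot_fst k v t)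
    (fun t _ => hasDerivAt_rot_snd k v t) (mem_univ s) (mem_univ (s + t))

theorem IsLeafArc.tendsto_start {S : Set H1} {e₁ : H1 → H1} {p : H1} {σ ε : ℝ} {γ : ℝ → H1}
    (hγ : IsLeafArc S e₁ p σ ε γ) : Tendsto γ (𝓝[>] 0) (𝓝 p) := by
  have := (hγ.continuousOn 0 ⟨le_rfl, hγ.pos⟩).tendsto
  rw [hγ.start] at this
  exact this.mono_left (nhdsWithin_le_of_mem (mem_of_superset (Ioo_mem_nhdsGT hγ.pos)
    Ioo_subset_Ico_self))

/-- If `η` is an integral curve of `e₁` (if `σ = 1`) or of `-e₁` (if `σ = -1`) in the regular part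
of a surface of constant `p`-mean curvature `c`, then its planar velocity turns at the rate
`σ * c`. Hence the curve is a piece of a helix. -/
theorem IsConstantPMeanCurvatureSurface.eq_helix {S : Set H1} {e₁ : H1 → H1} {c : ℝ}
    (hS : IsConstantPMeanCurvatureSurface S e₁ c) (hc : c ≠ 0) {σ : ℝ} (hσ : σ = 1 ∨ σ = -1)
    {I : Set ℝ} (hI : IsOpen I) (hI' : IsPreconnected I) {η : ℝ → H1}
    (hreg : ∀ t ∈ I, η t ∈ regularPart S) (hη : ∀ t ∈ I, HasDerivAt η (σ • e₁ (η t)) t)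
    {t₀ : ℝ} (ht₀ : t₀ ∈ I) :
    ∃ v : ℝ × ℝ, v.1 ^ 2 + v.2 ^ 2 = 1 ∧ ∀ t ∈ I,
      η t = helix (σ * c) (η t₀) v (t - t₀) ∧
      σ • e₁ (η t) = planarLift (η t) (rot (σ * c) v (t - t₀)) := by
  have hσ2 : σ * σ = 1 := by rcases hσ with rfl | rfl <;> norm_num
  have hσ0 : σ ≠ 0 := by rintro rfl; norm_num at hσ2
  set v : ℝ → ℝ × ℝ := fun t => ((σ • e₁ (η t)) 0, (σ • e₁ (η t)) 1) with hv
  have hlift : ∀ t ∈ I, planarLift (η t) (v t) = σ • e₁ (η t) := by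
    intro t ht
    have h := (hS.field.tangent _ (hreg t ht)).2
    have : σ • e₁ (η t) ∈ contactPlane (η t) := by
      have h' : contactForm (η t) (e₁ (η t)) = 0 := h
      show contactForm (η t) (σ • e₁ (η t)) = 0
      simp only [contactForm, Pi.smul_apply, smul_eq_mul] at h' ⊢
      linear_combination σ * h'
    exact planarLift_eq_of_mem_contactPlane this
  have hcov : ∀ t ∈ I, HasDerivAt (fun s => (v s).1) (-(σ * c) * (v t).2) t ∧
      HasDerivAt (fun s => (v s).2) (σ * c * (v t).1) t := by
    intro t ht
    -- the curvature is tested on the curve reparametrized so that its velocity is `e₁`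
    have hlin : HasDerivAt (fun s => t + σ * s) σ 0 := by
      simpa using ((hasDerivAt_id (0 : ℝ)).const_mul σ).const_add t
    have hlin' : HasDerivAt (fun s => σ * (s - t)) σ t := by
      simpa using ((hasDerivAt_id t).sub_const t).const_mul σ
    have hd : HasDerivAt (fun s => η (t + σ * s)) (e₁ (η t)) 0 := by
      have := HasDerivAt.scomp (g₁ := η) (g₁' := σ • e₁ (η t)) (0 : ℝ)
        (by simpa using hη t ht) hlin
      simpa [smul_smul, hσ2, Function.comp_def] using this
    have hev : ∀ᶠ s in 𝓝 (0 : ℝ), η (t + σ * s) ∈ S := by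
      have : Tendsto (fun s => t + σ * s) (𝓝 0) (𝓝 t) := by
        simpa using hlin.continuousAt.tendsto
      filter_upwards [this (hI.mem_nhds ht)] with s hs using (hreg _ hs).1
    have key := hS.curvature _ (hreg t ht) (fun s => η (t + σ * s)) (by simp) hev hd
    unfold HasCovDerivAt at key
    have k0 := hasDerivAt_pi.1 key 0
    have k1 := hasDerivAt_pi.1 key 1
    simp [frameCoord, crJ, frameX, frameY] at k0 k1
    have hback : ∀ s, t + σ * (σ * (s - t)) = s := fun s => by
      rw [← mul_assoc, hσ2]; ring
    have k0' := HasDerivAt.comp (h₂ := fun s => -e₁ (η (t + σ * s)) 1) t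
      (by simpa using k0) hlin'
    have k1' := HasDerivAt.comp (h₂ := fun s => e₁ (η (t + σ * s)) 0) t
      (by simpa using k1) hlin'
    simp only [Function.comp_def, hback] at k0' k1'
    constructor
    · refine (k1'.const_mul σ).congr_deriv ?_
      simp only [hv, Pi.smul_apply, smul_eq_mul]
      ring
    · have := (k0'.neg.const_mul σ)
      simp only [neg_neg, Pi.neg_apply] at this
      refine (this.congr_of_eventuallyEq (.of_forall fun s => by simp [hv])).congr_deriv ?_
      simp only [hv, Pi.smul_apply, smul_eq_mul]
      ring
  refine ⟨v t₀, ?_, fun t ht => ?_⟩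
  · have h := hS.field.unit _ (hreg t₀ ht₀)
    have h2 : contactForm (η t₀) (e₁ (η t₀)) = 0 := (hS.field.tangent _ (hreg t₀ ht₀)).2
    simp only [adaptedMetric, frameCoord, h2, Fin.sum_univ_three] at h
    simp at h
    simp only [hv, Pi.smul_apply, smul_eq_mul]
    linear_combination (e₁ (η t₀) 0 ^ 2 + e₁ (η t₀) 1 ^ 2) * hσ2 + h
  · have := eq_helix_of_hasDerivAt (mul_ne_zero hσ0 hc) hI hI'
      (fun t ht => by rw [hlift t ht]; exact hη t ht)
      (fun t ht => (hcov t ht).1) (fun t ht => (hcov t ht).2) ht₀ ht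
    refine ⟨this.1, ?_⟩
    rw [← this.2, hlift t ht]

/-! ### The leaves on one side of a singular curve -/

/-- The description near `p₀` of the side `0 < α` of the singular curve `Γ` in the surface
`S = {f = 0}`, inside the open set `R`. On this side the unit vector field with planar components
`w` spans the characteristic directions and is directed away from `Γ`, at a speed of at least `κ`
as measured by `α`; it has the limit `m` at `p₀`, and `e₁` is `w` up to the constant sign `σ`. -/
structure IsSideModel (S Γ : Set H1) (e₁ : H1 → H1) (σ κ : ℝ) (f α : H1 → ℝ) (w : H1 → ℝ × ℝ)
    (m : ℝ × ℝ) (p₀ : H1) (R : Set H1) : Prop where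
  isOpen : IsOpen R
  base_mem : p₀ ∈ R
  surface : ∀ q ∈ R, q ∈ S ↔ f q = 0
  differentiable_f : ∀ q ∈ R, DifferentiableAt ℝ f q
  differentiable_side : ∀ q ∈ R, DifferentiableAt ℝ α q
  base_singular : p₀ ∈ Γ
  singular : ∀ q ∈ R, q ∈ singularSet S → α q = 0
  curve : ∀ q ∈ R, q ∈ S → α q = 0 → q ∈ Γ
  subset : Γ ⊆ singularSet S
  smooth : ∀ q ∈ R, 0 < α q → ContDiffAt ℝ 1 w q
  unit : ∀ q ∈ R, 0 < α q → (w q).1 ^ 2 + (w q).2 ^ 2 = 1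
  tangent : ∀ q ∈ R, 0 < α q → fderiv ℝ f q (planarLift q (w q)) = 0
  sign : σ = 1 ∨ σ = -1
  field : ∀ q ∈ R, q ∈ S → 0 < α q → planarLift q (w q) = σ • e₁ q
  rate_pos : 0 < κ
  rate : ∀ q ∈ R, q ∈ S → 0 < α q → κ ≤ fderiv ℝ α q (planarLift q (w q))
  limit : Tendsto w (𝓝[S ∩ {q | 0 < α q}] p₀) (𝓝 m)
  neBot : (𝓝[S ∩ {q | 0 < α q}] p₀).NeBot

namespace IsSideModel

variable {S Γ : Set H1} {e₁ : H1 → H1} {c σ κ : ℝ} {f α : H1 → ℝ} {w : H1 → ℝ × ℝ}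
  {m : ℝ × ℝ} {p₀ : H1} {R : Set H1}

theorem sign_mul_self (h : IsSideModel S Γ e₁ σ κ f α w m p₀ R) : σ * σ = 1 := by
  rcases h.sign with hσ | hσ <;> rw [hσ] <;> norm_num

theorem curvature_ne_zero (h : IsSideModel S Γ e₁ σ κ f α w m p₀ R) (hc : c ≠ 0) :
    σ * c ≠ 0 := by
  rcases h.sign with hσ | hσ <;> rw [hσ] <;> simpa using hc

theorem side_base (h : IsSideModel S Γ e₁ σ κ f α w m p₀ R) : α p₀ = 0 :=
  h.singular p₀ h.base_mem (h.subset h.base_singular)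

theorem mem_regularPart (h : IsSideModel S Γ e₁ σ κ f α w m p₀ R) {q : H1} (hq : q ∈ R)
    (hS : q ∈ S) (hα : 0 < α q) : q ∈ regularPart S :=
  ⟨hS, fun hs => hα.ne' (h.singular q hq hs)⟩

theorem side_ne_zero (h : IsSideModel S Γ e₁ σ κ f α w m p₀ R) {q : H1} (hq : q ∈ R)
    (hreg : q ∈ regularPart S) : α q ≠ 0 :=
  fun h0 => hreg.2 (h.subset (h.curve q hq hreg.1 h0))

/-- Local existence of leaves: the field `w` is tangent to all level sets of `f`, so that its
integral curve from a point of `S` stays in `S`; there it is a helix. -/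
theorem exists_local_leaf (h : IsSideModel S Γ e₁ σ κ f α w m p₀ R)
    (hS : IsConstantPMeanCurvatureSurface S e₁ c) (hc : c ≠ 0) {q : H1} (hq : q ∈ R)
    (hqS : q ∈ S) (hα : 0 < α q) :
    ∃ ε > 0, ∀ t ∈ Ioo (-ε) ε, helix (σ * c) q (w q) t ∈ R ∧ helix (σ * c) q (w q) t ∈ S ∧
      0 < α (helix (σ * c) q (w q) t) ∧
      w (helix (σ * c) q (w q) t) = rot (σ * c) (w q) t := by
  have hW : ContDiffAt ℝ 1 (fun x => planarLift x (w x)) q :=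
    contDiff_planarLift.contDiffAt.comp q (contDiffAt_id.prodMk (h.smooth q hq hα))
  obtain ⟨η, hη0, ε, hε, hη⟩ :=
    hW.exists_forall_mem_closedBall_exists_eq_forall_mem_Ioo_hasDerivAt₀ 0
  simp only [zero_sub, zero_add] at hη
  have hcont : ContinuousAt η 0 := (hη 0 ⟨by linarith, hε⟩).continuousAt
  have hev : ∀ᶠ t in 𝓝 (0 : ℝ), η t ∈ R ∧ 0 < α (η t) := by
    rw [ContinuousAt, hη0] at hcont
    exact hcont ((h.isOpen.eventually_mem hq).and
      ((h.differentiable_side q hq).continuousAt.eventually (lt_mem_nhds hα)))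
  obtain ⟨δ', hδ', hball⟩ := Metric.eventually_nhds_iff.1 hev
  obtain ⟨δ, hδ, hδε, hδδ⟩ : ∃ δ > 0, δ ≤ ε ∧ δ ≤ δ' :=
    ⟨min ε δ', lt_min hε hδ', min_le_left _ _, min_le_right _ _⟩
  have hin : ∀ t ∈ Ioo (-δ) δ, η t ∈ R ∧ 0 < α (η t) := fun t ht =>
    hball (by rw [Real.dist_eq, sub_zero]; exact (abs_lt.2 ht).trans_le hδδ)
  have hd : ∀ t ∈ Ioo (-δ) δ, HasDerivAt η (planarLift (η t) (w (η t))) t := fun t ht =>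
    hη t ⟨by linarith [ht.1], by linarith [ht.2]⟩
  have h0 : (0 : ℝ) ∈ Ioo (-δ) δ := ⟨by linarith, hδ⟩
  have hmem : ∀ t ∈ Ioo (-δ) δ, η t ∈ S := by
    intro t ht
    have hf : ∀ s ∈ Ioo (-δ) δ, HasDerivAt (fun s => f (η s)) 0 s := fun s hs => by
      rw [← h.tangent (η s) (hin s hs).1 (hin s hs).2]
      exact (h.differentiable_f _ (hin s hs).1).hasFDerivAt.comp_hasDerivAt s (hd s hs)
    have := isOpen_Ioo.is_const_of_deriv_eq_zero isPreconnected_Ioo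
      (fun s hs => (hf s hs).differentiableAt.differentiableWithinAt)
      (fun s hs => (hf s hs).deriv) ht h0
    rw [h.surface _ (hin t ht).1, this, hη0, ← h.surface q hq]
    exact hqS
  have hfield : ∀ t ∈ Ioo (-δ) δ, planarLift (η t) (w (η t)) = σ • e₁ (η t) := fun t ht =>
    h.field _ (hin t ht).1 (hmem t ht) (hin t ht).2
  obtain ⟨v, -, hv⟩ := hS.eq_helix hc h.sign isOpen_Ioo isPreconnected_Ioo
    (fun t ht => h.mem_regularPart (hin t ht).1 (hmem t ht) (hin t ht).2)
    (fun t ht => (hfield t ht) ▸ hd t ht) h0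
  simp only [sub_zero, hη0] at hv
  have hwv : w q = v := by
    have := (hv 0 h0).2
    rw [← hfield 0 h0, hη0, rot_zero] at this
    exact planarLift_injective _ this
  refine ⟨δ, hδ, fun t ht => ?_⟩
  obtain ⟨e1, e2⟩ := hv t ht
  rw [hwv, ← e1]
  refine ⟨(hin t ht).1, hmem t ht, (hin t ht).2, planarLift_injective (η t) ?_⟩
  rw [hfield t ht, e2]

/-- A helix that is an integral curve of `w` on this side moves away from `Γ` at the rate `κ`. -/
theorem side_add_le (h : IsSideModel S Γ e₁ σ κ f α w m p₀ R) (hc : c ≠ 0) {q : H1} {v : ℝ × ℝ}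
    {s t : ℝ} (hst : s ≤ t)
    (hG : ∀ r ∈ Icc s t, helix (σ * c) q v r ∈ R)
    (hG' : ∀ r ∈ Ioo s t, helix (σ * c) q v r ∈ S ∧
      0 < α (helix (σ * c) q v r) ∧ w (helix (σ * c) q v r) = rot (σ * c) v r) :
    α (helix (σ * c) q v s) + κ * (t - s) ≤ α (helix (σ * c) q v t) := by
  have hd : ∀ r ∈ Icc s t, HasDerivAt (fun r => α (helix (σ * c) q v r))
      (fderiv ℝ α (helix (σ * c) q v r)
        (planarLift (helix (σ * c) q v r) (rot (σ * c) v r))) r := fun r hr =>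
    (h.differentiable_side _ (hG r hr)).hasFDerivAt.comp_hasDerivAt r
      (hasDerivAt_helix (h.curvature_ne_zero hc) q v r)
  have := (convex_Icc s t).mul_sub_le_image_sub_of_le_deriv
    (f := fun r => α (helix (σ * c) q v r)) (C := κ)
    (fun r hr => (hd r hr).continuousAt.continuousWithinAt)
    (fun r hr => (hd r (interior_subset hr)).differentiableAt.differentiableWithinAt)
    (fun r hr => by
      rw [(hd r (interior_subset hr)).deriv]
      rw [interior_Icc] at hr
      obtain ⟨h1, h2, h3⟩ := hG' r hr
      rw [← h3]
      exact h.rate _ (hG r (Ioo_subset_Icc_self hr)) h1 h2)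
    s (left_mem_Icc.2 hst) t (right_mem_Icc.2 hst) hst
  linarith

/-- Helices that start near `p₀` with unit planar velocity stay in `R` for a uniform time. -/
theorem exists_helix_mem (h : IsSideModel S Γ e₁ σ κ f α w m p₀ R) (k : ℝ) :
    ∃ V ∈ 𝓝 p₀, ∃ T > 0, ∀ q ∈ V, ∀ v : ℝ × ℝ, v.1 ^ 2 + v.2 ^ 2 = 1 → ∀ t ∈ Icc (-T) T,
      helix k q v t ∈ R := by
  have hK : IsCompact {v : ℝ × ℝ | v.1 ^ 2 + v.2 ^ 2 = 1} := by
    refine (isCompact_Icc (a := ((-1, -1) : ℝ × ℝ)) (b := (1, 1))).of_isClosed_subset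
      (isClosed_eq (by fun_prop) (by fun_prop)) fun v hv => ?_
    have hv' : v.1 ^ 2 + v.2 ^ 2 = 1 := hv
    have h1 := abs_le.1 ((sq_le_one_iff_abs_le_one v.1).1 (by nlinarith [sq_nonneg v.2]))
    have h2 := abs_le.1 ((sq_le_one_iff_abs_le_one v.2).1 (by nlinarith [sq_nonneg v.1]))
    exact ⟨⟨h1.1, h2.1⟩, ⟨h1.2, h2.2⟩⟩
  have hev : ∀ᶠ x : H1 × ℝ in 𝓝 (p₀, 0), ∀ v ∈ {v : ℝ × ℝ | v.1 ^ 2 + v.2 ^ 2 = 1},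
      helix k x.1 v x.2 ∈ R := by
    refine hK.eventually_forall_of_forall_eventually fun v _ => ?_
    exact (continuous_helix_uncurry k).continuousAt.preimage_mem_nhds
      (h.isOpen.mem_nhds (by simpa using h.base_mem))
  rw [nhds_prod_eq] at hev
  obtain ⟨V, hV, N, hN, hVN⟩ := eventually_prod_iff.1 hev
  obtain ⟨ε, hε, hball⟩ := Metric.eventually_nhds_iff.1 hN
  refine ⟨{q | V q}, hV, ε / 2, half_pos hε, fun q hq v hv t ht => hVN hq (hball ?_) v hv⟩
  rw [Real.dist_eq, sub_zero]
  exact (abs_le.2 ht).trans_lt (half_lt_self hε)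

/-- From points near `p₀`, the leaves can be followed away from `Γ` for a uniform time. -/
theorem exists_uniform_leaf (h : IsSideModel S Γ e₁ σ κ f α w m p₀ R)
    (hS : IsConstantPMeanCurvatureSurface S e₁ c) (hc : c ≠ 0) :
    ∃ V ∈ 𝓝 p₀, ∃ T > 0, ∀ q ∈ V, q ∈ S → 0 < α q → ∀ t ∈ Icc 0 T,
      helix (σ * c) q (w q) t ∈ R ∧ helix (σ * c) q (w q) t ∈ S ∧
      κ * t ≤ α (helix (σ * c) q (w q) t) ∧
      w (helix (σ * c) q (w q) t) = rot (σ * c) (w q) t := by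
  obtain ⟨V, hV, T, hT, hVT⟩ := h.exists_helix_mem (σ * c)
  have hk := h.curvature_ne_zero hc
  refine ⟨V ∩ R, inter_mem hV (h.isOpen.mem_nhds h.base_mem), T, hT, fun q hq hqS hα => ?_⟩
  set G := helix (σ * c) q (w q) with hG
  have hGc : Continuous G := (contDiff_helix (n := 0) _ _ _).continuous
  have hR : ∀ t ∈ Icc 0 T, G t ∈ R := fun t ht =>
    hVT q hq.1 _ (h.unit q hq.2 hα) t ⟨by linarith [ht.1], ht.2⟩
  have hpos : ∀ t ∈ Icc 0 T, α q + κ * t ≤ α (G t) → 0 < α (G t) := fun t ht hle => by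
    have := mul_nonneg h.rate_pos.le ht.1
    linarith
  -- continuous induction along the helix
  have key : Icc 0 T ⊆ {t | f (G t) = 0 ∧ α q + κ * t ≤ α (G t) ∧
      w (G t) = rot (σ * c) (w q) t} := by
    refine IsClosed.Icc_subset_of_forall_exists_gt ?_ ?_ ?_
    · have hA : IsClosed (Icc 0 T ∩ {t | f (G t) = 0 ∧ α q + κ * t ≤ α (G t)}) := by
        have hc1 : ContinuousOn (fun t => (f (G t), α (G t) - (α q + κ * t))) (Icc 0 T) := by
          refine ContinuousOn.prodMk (fun t ht => ?_) (ContinuousOn.sub (fun t ht => ?_)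
            (by fun_prop))
          · exact ((h.differentiable_f _ (hR t ht)).continuousAt.comp
              hGc.continuousAt).continuousWithinAt
          · exact ((h.differentiable_side _ (hR t ht)).continuousAt.comp
              hGc.continuousAt).continuousWithinAt
        have := hc1.preimage_isClosed_of_isClosed isClosed_Icc
          (isClosed_singleton (x := (0 : ℝ)).prod (isClosed_Ici (a := (0 : ℝ))))
        convert this using 2
        ext t
        simp
      have hc2 : ContinuousOn (fun t => w (G t) - rot (σ * c) (w q) t)
          (Icc 0 T ∩ {t | f (G t) = 0 ∧ α q + κ * t ≤ α (G t)}) := by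
        refine ContinuousOn.sub (fun t ht => ?_) (continuous_rot _ _).continuousOn
        exact ((h.smooth _ (hR t ht.1) (hpos t ht.1 ht.2.2)).continuousAt.comp
              hGc.continuousAt).continuousWithinAt
      convert hc2.preimage_isClosed_of_isClosed hA (isClosed_singleton (x := (0 : ℝ × ℝ))) using 1
      ext t
      simp only [mem_inter_iff, mem_ofPred_eq, mem_preimage, mem_singleton_iff, sub_eq_zero]
      tauto
    · simp [hG, (h.surface q hq.2).1 hqS]
    · rintro t ⟨⟨ht1, ht2, ht3⟩, ht⟩ y hy
      have htI := Ico_subset_Icc_self ht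
      obtain ⟨ε, hε, hloc⟩ := h.exists_local_leaf hS hc (hR t htI)
        ((h.surface _ (hR t htI)).2 ht1) (hpos t htI ht2)
      rw [ht3] at hloc
      have hadd : ∀ r, helix (σ * c) (G t) (rot (σ * c) (w q) t) r = G (t + r) := fun r =>
        ((helix_add hk q (w q) t r).1).symm
      have hadd' : ∀ r, rot (σ * c) (rot (σ * c) (w q) t) r = rot (σ * c) (w q) (t + r) :=
        fun r => ((helix_add hk q (w q) t r).2).symm
      obtain ⟨δ, hδ, hδε, hδy⟩ : ∃ δ > 0, δ < ε ∧ δ ≤ y - t :=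
        ⟨min (ε / 2) (y - t), lt_min (half_pos hε) (sub_pos.2 hy),
          (min_le_left _ _).trans_lt (half_lt_self hε), min_le_right _ _⟩
      have hδ0 := hloc δ ⟨by linarith, hδε⟩
      rw [hadd, hadd'] at hδ0
      refine ⟨t + δ, ⟨(h.surface _ hδ0.1).1 hδ0.2.1, ?_, hδ0.2.2.2⟩, by linarith, by linarith⟩
      have := h.side_add_le hc (q := G t) (v := rot (σ * c) (w q) t) hδ.le
        (fun r hr => (hloc r ⟨by linarith [hr.1], by linarith [hr.2]⟩).1)
        (fun r hr => (hloc r ⟨by linarith [hr.1], by linarith [hr.2]⟩).2)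
      rw [hadd, hadd, add_zero] at this
      linarith
  intro t ht
  obtain ⟨h1, h2, h3⟩ := key ht
  exact ⟨hR t ht, (h.surface _ (hR t ht)).2 h1, by linarith, h3⟩

/-- A leaf arrives at `p₀` on this side, as the limit of the leaves through nearby points. -/
theorem exists_isLeafArc (h : IsSideModel S Γ e₁ σ κ f α w m p₀ R)
    (hS : IsConstantPMeanCurvatureSurface S e₁ c) (hc : c ≠ 0) :
    ∃ T > 0, IsLeafArc S e₁ p₀ σ T (helix (σ * c) p₀ m) ∧
      ∀ t ∈ Ioo 0 T, helix (σ * c) p₀ m t ∈ R ∧ 0 < α (helix (σ * c) p₀ m t) := by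
  obtain ⟨V, hV, T, hT, hVT⟩ := h.exists_uniform_leaf hS hc
  have hk := h.curvature_ne_zero hc
  have := h.neBot
  obtain ⟨V', hV', T', hT', hVT'⟩ := h.exists_helix_mem (σ * c)
  have hev : ∀ᶠ q in 𝓝[S ∩ {q | 0 < α q}] p₀, q ∈ S ∧ 0 < α q ∧ q ∈ V ∧ q ∈ R := by
    filter_upwards [self_mem_nhdsWithin, mem_nhdsWithin_of_mem_nhds hV,
      mem_nhdsWithin_of_mem_nhds (h.isOpen.mem_nhds h.base_mem)] with q h1 h2 h3
    exact ⟨h1.1, h1.2, h2, h3⟩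
  have hm : m.1 ^ 2 + m.2 ^ 2 = 1 := by
    have hl : Tendsto (fun q => (w q).1 ^ 2 + (w q).2 ^ 2) (𝓝[S ∩ {q | 0 < α q}] p₀)
        (𝓝 (m.1 ^ 2 + m.2 ^ 2)) :=
      ((continuous_fst.pow 2).add (continuous_snd.pow 2)).continuousAt.tendsto.comp h.limit
    refine tendsto_nhds_unique_of_eventuallyEq hl tendsto_const_nhds ?_
    filter_upwards [hev] with q hq using h.unit q hq.2.2.2 hq.2.1
  have hid : Tendsto (fun q : H1 => q) (𝓝[S ∩ {q | 0 < α q}] p₀) (𝓝 p₀) :=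
    tendsto_id.mono_left nhdsWithin_le_nhds
  have hlim : ∀ t, Tendsto (fun q => helix (σ * c) q (w q) t) (𝓝[S ∩ {q | 0 < α q}] p₀)
      (𝓝 (helix (σ * c) p₀ m t)) := fun t =>
    ((continuous_helix_uncurry (σ * c)).tendsto ((p₀, t), m)).comp
      ((hid.prodMk_nhds tendsto_const_nhds).prodMk_nhds h.limit)
  have hrot : ∀ t, Tendsto (fun q => rot (σ * c) (w q) t) (𝓝[S ∩ {q | 0 < α q}] p₀)
      (𝓝 (rot (σ * c) m t)) := fun t => by
    have : Continuous fun v => rot (σ * c) v t := by unfold rot; fun_prop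
    exact (this.tendsto m).comp h.limit
  have hmain : ∀ t ∈ Ioo 0 (min T T'), helix (σ * c) p₀ m t ∈ R ∧ helix (σ * c) p₀ m t ∈ S ∧
      0 < α (helix (σ * c) p₀ m t) ∧ w (helix (σ * c) p₀ m t) = rot (σ * c) m t := by
    intro t ht
    have htT : t ∈ Icc 0 T := ⟨ht.1.le, ht.2.le.trans (min_le_left _ _)⟩
    have hR : helix (σ * c) p₀ m t ∈ R := hVT' p₀ (mem_of_mem_nhds hV') m hm t
      ⟨by linarith [ht.1], ht.2.le.trans (min_le_right _ _)⟩
    have hSt : helix (σ * c) p₀ m t ∈ S := by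
      rw [h.surface _ hR]
      refine tendsto_nhds_unique_of_eventuallyEq
        ((h.differentiable_f _ hR).continuousAt.tendsto.comp (hlim t)) tendsto_const_nhds ?_
      filter_upwards [hev] with q hq
      obtain ⟨h1, h2, -, -⟩ := hVT q hq.2.2.1 hq.1 hq.2.1 t htT
      exact (h.surface _ h1).1 h2
    have hα : 0 < α (helix (σ * c) p₀ m t) := by
      refine (mul_pos h.rate_pos ht.1).trans_le
        (ge_of_tendsto ((h.differentiable_side _ hR).continuousAt.tendsto.comp (hlim t)) ?_)
      filter_upwards [hev] with q hq
      exact (hVT q hq.2.2.1 hq.1 hq.2.1 t htT).2.2.1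
    refine ⟨hR, hSt, hα, ?_⟩
    refine tendsto_nhds_unique_of_eventuallyEq
      ((h.smooth _ hR hα).continuousAt.tendsto.comp (hlim t)) (hrot t) ?_
    filter_upwards [hev] with q hq
    exact (hVT q hq.2.2.1 hq.1 hq.2.1 t htT).2.2.2
  refine ⟨min T T', lt_min hT hT', ⟨lt_min hT hT', h.sign, helix_zero _ _ _,
    (contDiff_helix (n := 0) _ _ _).continuous.continuousOn, fun t ht => ?_, fun t ht => ?_⟩,
    fun t ht => ⟨(hmain t ht).1, (hmain t ht).2.2.1⟩⟩
  · obtain ⟨h1, h2, h3, -⟩ := hmain t ht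
    exact h.mem_regularPart h1 h2 h3
  · obtain ⟨h1, h2, h3, h4⟩ := hmain t ht
    rw [← h.field _ h1 h2 h3, h4]
    exact hasDerivAt_helix hk p₀ m t

/-- Every leaf arc that arrives at `p₀` on this side is the helix with initial velocity `m`. -/
theorem eq_helix_of_isLeafArc (h : IsSideModel S Γ e₁ σ κ f α w m p₀ R)
    (hS : IsConstantPMeanCurvatureSurface S e₁ c) (hc : c ≠ 0) {σ' ε : ℝ} {γ : ℝ → H1}
    (hγ : IsLeafArc S e₁ p₀ σ' ε γ) (hside : ∀ᶠ t in 𝓝[>] (0 : ℝ), 0 < α (γ t)) :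
    σ' = σ ∧ ∀ t ∈ Ico 0 ε, γ t = helix (σ * c) p₀ m t := by
  have hε := hγ.pos
  have hσ'2 : σ' * σ' = 1 := by rcases hγ.sign with hσ | hσ <;> rw [hσ] <;> norm_num
  have hσ'0 : σ' ≠ 0 := by rintro rfl; norm_num at hσ'2
  have hk : σ' * c ≠ 0 := mul_ne_zero hσ'0 hc
  obtain ⟨v, -, hv⟩ := hS.eq_helix hc hγ.sign isOpen_Ioo isPreconnected_Ioo hγ.regular
    hγ.deriv (t₀ := ε / 2) ⟨by linarith, by linarith⟩
  -- the helix, restarted at time `0`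
  set p' := helix (σ' * c) (γ (ε / 2)) v (-(ε / 2)) with hp'
  set m' := rot (σ' * c) v (-(ε / 2)) with hm'
  have hadd : ∀ t, helix (σ' * c) (γ (ε / 2)) v (t - ε / 2) = helix (σ' * c) p' m' t ∧
      rot (σ' * c) v (t - ε / 2) = rot (σ' * c) m' t := fun t => by
    rw [sub_eq_neg_add]
    exact helix_add hk _ _ _ _
  simp only [(hadd _).1, (hadd _).2] at hv
  have hG : Continuous (helix (σ' * c) p' m') := (contDiff_helix (n := 0) _ _ _).continuous
  have hIoo : ∀ᶠ t in 𝓝[>] (0 : ℝ), t ∈ Ioo 0 ε := Ioo_mem_nhdsGT hε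
  have hp : p' = p₀ := by
    have h2 : Tendsto (helix (σ' * c) p' m') (𝓝[>] 0) (𝓝 p') := by
      simpa using (hG.tendsto 0).mono_left nhdsWithin_le_nhds
    refine (tendsto_nhds_unique_of_eventuallyEq hγ.tendsto_start h2 ?_).symm
    filter_upwards [hIoo] with t ht using (hv t ht).1
  rw [hp] at hv hG
  have hGlim : Tendsto (helix (σ' * c) p₀ m') (𝓝[>] 0) (𝓝 p₀) := by
    simpa using (hG.tendsto 0).mono_left nhdsWithin_le_nhds
  have hev : ∀ᶠ t in 𝓝[>] (0 : ℝ), helix (σ' * c) p₀ m' t ∈ R ∧ helix (σ' * c) p₀ m' t ∈ S ∧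
      0 < α (helix (σ' * c) p₀ m' t) ∧
      w (helix (σ' * c) p₀ m' t) = (σ * σ') • rot (σ' * c) m' t := by
    filter_upwards [hIoo, hside, hGlim (h.isOpen.mem_nhds h.base_mem)] with t ht ht1 ht2
    obtain ⟨e1, e2⟩ := hv t ht
    have hSt := (hγ.regular t ht).1
    rw [e1] at ht1 e2 hSt
    refine ⟨ht2, hSt, ht1, planarLift_injective (helix (σ' * c) p₀ m' t) ?_⟩
    rw [planarLift_smul, ← e2, h.field _ ht2 hSt ht1, smul_smul, mul_assoc, hσ'2, mul_one]
  have hσσ : σ * σ' = 1 := by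
    by_contra hne
    have hneg : σ * σ' = -1 := by
      have hsq : σ * σ' * (σ * σ') = 1 := by
        linear_combination σ' * σ' * h.sign_mul_self + hσ'2
      exact (mul_self_eq_one_iff.1 hsq).resolve_left hne
    -- otherwise the arc would move towards `Γ`, where it starts
    obtain ⟨δ, hδ, hball⟩ := mem_nhdsGT_iff_exists_Ioc_subset.1 hev
    have hδ0 : (0 : ℝ) < δ := hδ
    have hRI : ∀ r ∈ Icc 0 δ, helix (σ' * c) p₀ m' r ∈ R := by
      intro r hr
      rcases hr.1.eq_or_lt with rfl | h0
      · simpa using h.base_mem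
      · exact (hball ⟨h0, hr.2⟩).1
    have hd : ∀ r ∈ Icc 0 δ, HasDerivAt (fun r => α (helix (σ' * c) p₀ m' r))
        (fderiv ℝ α (helix (σ' * c) p₀ m' r)
          (planarLift (helix (σ' * c) p₀ m' r) (rot (σ' * c) m' r))) r := fun r hr =>
      (h.differentiable_side _ (hRI r hr)).hasFDerivAt.comp_hasDerivAt r
        (hasDerivAt_helix hk p₀ m' r)
    have hanti := antitoneOn_of_deriv_nonpos (convex_Icc 0 δ)
      (f := fun r => α (helix (σ' * c) p₀ m' r))
      (fun r hr => (hd r hr).continuousAt.continuousWithinAt)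
      (fun r hr => (hd r (interior_subset hr)).differentiableAt.differentiableWithinAt)
      (fun r hr => by
        rw [(hd r (interior_subset hr)).deriv]
        rw [interior_Icc] at hr
        obtain ⟨h1, h2, h3, h4⟩ := hball (Ioo_subset_Ioc_self hr)
        have hr' : rot (σ' * c) m' r = -w (helix (σ' * c) p₀ m' r) := by
          rw [h4, hneg]; simp
        have := h.rate _ h1 h2 h3
        rw [hr', planarLift_neg, map_neg]
        linarith [h.rate_pos])
    have h1 := hanti (left_mem_Icc.2 hδ0.le) (right_mem_Icc.2 hδ0.le) hδ0.le
    have h2 : 0 < α (helix (σ' * c) p₀ m' δ) := (hball (right_mem_Ioc.2 hδ0)).2.2.1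
    simp only [helix_zero, h.side_base] at h1
    linarith
  have hσ : σ' = σ := by linear_combination σ * hσσ - σ' * h.sign_mul_self
  subst hσ
  have hm : m' = m := by
    have h1 : Tendsto (fun t => w (helix (σ' * c) p₀ m' t)) (𝓝[>] 0) (𝓝 m) := by
      refine h.limit.comp (tendsto_nhdsWithin_iff.2 ⟨hGlim, ?_⟩)
      filter_upwards [hev] with t ht using ⟨ht.2.1, ht.2.2.1⟩
    have h2 : Tendsto (rot (σ' * c) m') (𝓝[>] 0) (𝓝 m') := by
      simpa using ((continuous_rot (σ' * c) m').tendsto 0).mono_left nhdsWithin_le_nhds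
    refine (tendsto_nhds_unique_of_eventuallyEq h1 h2 ?_).symm
    filter_upwards [hev] with t ht
    rw [ht.2.2.2, hσσ, one_smul]
  subst hm
  refine ⟨rfl, fun t ht => ?_⟩
  rcases ht.1.eq_or_lt with rfl | h0
  · rw [helix_zero, hγ.start]
  · exact (hv t ⟨h0, ht.2⟩).1

/-- A leaf that comes close to `p₀` on this side runs, backwards along `w`, into `Γ`: it is a helix
along which `α` decreases at the rate `κ`, and it cannot end before `α` vanishes. -/
theorem exists_leaf_end (h : IsSideModel S Γ e₁ σ κ f α w m p₀ R)
    (hS : IsConstantPMeanCurvatureSurface S e₁ c) (hc : c ≠ 0) :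
    ∃ U ∈ 𝓝 p₀, ∀ (I : Set ℝ) (γ : ℝ → H1), IsLeaf S e₁ I γ →
      (∃ t ∈ I, γ t ∈ U ∧ 0 < α (γ t)) →
      ∃ (b : ℝ) (p : H1), (IsLUB I b ∨ IsGLB I b) ∧ p ∈ Γ ∧
        ContDiffOn ℝ ∞ (Function.update γ b p) (insert b I) := by
  obtain ⟨V, hV, T, hT, hVT⟩ := h.exists_helix_mem (σ * c)
  have hk := h.curvature_ne_zero hc
  have hσ2 := h.sign_mul_self
  have hnear : ∀ᶠ q in 𝓝 p₀, α q < κ * T :=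
    (h.differentiable_side _ h.base_mem).continuousAt.eventually
      (gt_mem_nhds (by rw [h.side_base]; exact mul_pos h.rate_pos hT))
  refine ⟨{q | q ∈ V ∧ q ∈ R ∧ α q < κ * T},
    Filter.Eventually.and hV ((h.isOpen.eventually_mem h.base_mem).and hnear), ?_⟩
  rintro I γ hγ ⟨t₀, ht₀, ⟨hqV, hqR, hqα⟩, hq0⟩
  set q := γ t₀ with hq
  have hqS : q ∈ S := (hγ.curve t₀ ht₀).1.1
  obtain ⟨v, -, hv⟩ := hS.eq_helix hc (σ := 1) (Or.inl rfl) hγ.isOpen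
    hγ.ordConnected.isPreconnected (fun t ht => (hγ.curve t ht).1)
    (fun t ht => by simpa using (hγ.curve t ht).2) ht₀
  simp only [one_mul, one_smul] at hv
  have hwv : w q = σ • v := by
    refine planarLift_injective q ?_
    rw [h.field q hqR hqS hq0, planarLift_smul, (hv t₀ ht₀).2]
    simp [hq]
  -- the leaf as a helix in the direction of `w`, with the time parameter `s`, `t = t₀ + σ * s`
  set G := helix (σ * c) q (w q) with hG
  have hGsm : ContDiff ℝ ∞ G := contDiff_helix _ _ _
  have hGc : Continuous G := hGsm.continuous
  have hγG : ∀ t ∈ I, γ t = G (σ * (t - t₀)) ∧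
      σ • e₁ (γ t) = planarLift (γ t) (rot (σ * c) (w q) (σ * (t - t₀))) := by
    intro t ht
    obtain ⟨e1, e2⟩ := hv t ht
    rw [hG, e2, ← planarLift_smul, hwv]
    rw [← hq] at e1
    rcases h.sign with hσ | hσ
    · rw [hσ]
      simp only [one_mul, one_smul]
      exact ⟨e1, trivial⟩
    · rw [hσ]
      simp only [neg_one_mul, neg_one_smul]
      rw [helix_neg_neg, neg_neg]
      refine ⟨e1, ?_⟩
      rw [rot_neg_vec, rot_neg_neg]
  set I' := {s | t₀ + σ * s ∈ I} with hI'
  have hI'open : IsOpen I' := hγ.isOpen.preimage (by fun_prop)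
  have hlin : ∀ s, σ * (t₀ + σ * s - t₀) = s := fun s => by
    rw [add_sub_cancel_left, ← mul_assoc, hσ2, one_mul]
  have hlin' : ∀ t, t₀ + σ * (σ * (t - t₀)) = t := fun t => by
    rw [← mul_assoc, hσ2]; ring
  have hI'ord : I'.OrdConnected := by
    refine ⟨fun a ha b hb x hx => ?_⟩
    rcases h.sign with hσ | hσ
    · simp only [hI', hσ, mem_ofPred_eq] at ha hb ⊢
      exact hγ.ordConnected.out ha hb ⟨by linarith [hx.1], by linarith [hx.2]⟩
    · simp only [hI', hσ, mem_ofPred_eq] at ha hb ⊢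
      exact hγ.ordConnected.out hb ha ⟨by linarith [hx.2], by linarith [hx.1]⟩
  have h0I' : (0 : ℝ) ∈ I' := by simpa [hI'] using ht₀
  have hreg : ∀ s ∈ I', G s ∈ regularPart S ∧
      σ • e₁ (G s) = planarLift (G s) (rot (σ * c) (w q) s) := by
    intro s hs
    obtain ⟨e1, e2⟩ := hγG _ hs
    rw [hlin] at e1 e2
    rw [← e1]
    exact ⟨(hγ.curve _ hs).1, e2⟩
  have hR : ∀ s ∈ Icc (-T) T, G s ∈ R := fun s hs =>
    hVT q hqV _ (h.unit q hqR hq0) s hs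
  -- up to the time `-T`, the leaf stays on the side `0 < α`
  have hpos : ∀ s ∈ I' ∩ Icc (-T) 0, 0 < α (G s) := by
    intro s hs
    have hsub : Icc s 0 ⊆ I' := hI'ord.out hs.1 h0I'
    have hT' : ∀ r ∈ Icc s 0, r ∈ Icc (-T) T := fun r hr =>
      ⟨hs.2.1.trans hr.1, hr.2.trans hT.le⟩
    have hc1 : ContinuousOn (fun r => α (G r)) (Icc s 0) := fun r hr =>
      ((h.differentiable_side _ (hR r (hT' r hr))).continuousAt.comp
        hGc.continuousAt).continuousWithinAt
    by_contra hneg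
    obtain ⟨r, hr, hr0⟩ := intermediate_value_Icc hs.2.2 hc1
      (show (0 : ℝ) ∈ Icc (α (G s)) (α (G 0)) from
        ⟨not_lt.1 hneg, by simpa [hG] using hq0.le⟩)
    exact h.side_ne_zero (hR r (hT' r hr)) (hreg r (hsub hr)).1 hr0
  have hw : ∀ s ∈ I' ∩ Icc (-T) 0, w (G s) = rot (σ * c) (w q) s := fun s hs =>
    planarLift_injective (G s) (by
      rw [h.field _ (hR s ⟨hs.2.1, hs.2.2.trans hT.le⟩) (hreg s hs.1).1.1 (hpos s hs),
        (hreg s hs.1).2])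
  have hdec : ∀ s ∈ I' ∩ Icc (-T) 0, -T < s := by
    intro s hs
    have hsub : Icc s 0 ⊆ I' := hI'ord.out hs.1 h0I'
    have hsub' : ∀ r ∈ Icc s 0, r ∈ I' ∩ Icc (-T) 0 := fun r hr =>
      ⟨hsub hr, hs.2.1.trans hr.1, hr.2⟩
    have := h.side_add_le hc (q := q) (v := w q) hs.2.2
      (fun r hr => hR r ⟨(hsub' r hr).2.1, hr.2.trans hT.le⟩)
      (fun r hr => ⟨(hreg r (hsub (Ioo_subset_Icc_self hr))).1.1,
        hpos r (hsub' r (Ioo_subset_Icc_self hr)), hw r (hsub' r (Ioo_subset_Icc_self hr))⟩)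
    rw [helix_zero] at this
    have h2 := hpos s hs
    by_contra hle
    have : κ * T ≤ κ * (0 - s) := mul_le_mul_of_nonneg_left (by linarith) h.rate_pos.le
    linarith
  have hlow : ∀ s ∈ I', -T < s := by
    intro s hs
    by_contra hle
    have := hdec (-T) ⟨hI'ord.out hs h0I' ⟨not_lt.1 hle, by linarith⟩, le_rfl, by linarith⟩
    exact lt_irrefl _ this
  have hbdd : BddBelow I' := ⟨-T, fun s hs => (hlow s hs).le⟩
  set b := sInf I' with hb
  have hglb : IsGLB I' b := isGLB_csInf ⟨0, h0I'⟩ hbdd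
  have hbT : -T ≤ b := hglb.2 fun s hs => (hlow s hs).le
  have hb0 : b ≤ 0 := hglb.1 h0I'
  have hbI : b ∉ I' := fun hbI => by
    obtain ⟨l, hl, hl'⟩ := exists_Ioc_subset_of_mem_nhds (hI'open.mem_nhds hbI) ⟨b - 1, by linarith⟩
    have := hglb.1 (hl' (show (l + b) / 2 ∈ Ioc l b from ⟨by linarith, by linarith⟩))
    linarith
  have hblt : b < 0 := hb0.lt_of_ne fun he => hbI (he ▸ h0I')
  have hIoc : ∀ s ∈ Ioc b 0, s ∈ I' ∩ Icc (-T) 0 := by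
    intro s hs
    obtain ⟨r, hr, hrs⟩ := (isGLB_lt_iff hglb).1 hs.1
    exact ⟨hI'ord.out hr h0I' ⟨hrs.le, hs.2⟩, hbT.trans hs.1.le, hs.2⟩
  have hev : ∀ᶠ s in 𝓝[>] b, s ∈ I' ∩ Icc (-T) 0 := by
    filter_upwards [Ioc_mem_nhdsGT hblt] with s hs using hIoc s hs
  have hGb : Tendsto G (𝓝[>] b) (𝓝 (G b)) := (hGc.tendsto b).mono_left nhdsWithin_le_nhds
  have hbR : G b ∈ R := hR b ⟨hbT, by linarith⟩
  have hbS : G b ∈ S := by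
    rw [h.surface _ hbR]
    refine tendsto_nhds_unique_of_eventuallyEq
      ((h.differentiable_f _ hbR).continuousAt.tendsto.comp hGb) tendsto_const_nhds ?_
    filter_upwards [hev] with s hs
    exact (h.surface _ (hR s ⟨hs.2.1, hs.2.2.trans hT.le⟩)).1 (hreg s hs.1).1.1
  have hbα : 0 ≤ α (G b) := by
    refine ge_of_tendsto ((h.differentiable_side _ hbR).continuousAt.tendsto.comp hGb) ?_
    filter_upwards [hev] with s hs using (hpos s hs).le
  have hbΓ : G b ∈ Γ := by
    refine h.curve _ hbR hbS (hbα.eq_or_lt.resolve_right fun hα => ?_).symm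
    -- at a point with `0 < α`, the leaf could be continued
    obtain ⟨ε, hε, hloc⟩ := h.exists_local_leaf hS hc hbR hbS hα
    have hwb : w (G b) = rot (σ * c) (w q) b := by
      refine tendsto_nhds_unique_of_eventuallyEq
        ((h.smooth _ hbR hα).continuousAt.tendsto.comp hGb)
        (((continuous_rot (σ * c) (w q)).tendsto b).mono_left nhdsWithin_le_nhds) ?_
      filter_upwards [hev] with s hs using hw s hs
    have hext : ∀ s ∈ Ioo (b - ε) (b + ε), G s ∈ regularPart S ∧
        σ • e₁ (G s) = planarLift (G s) (rot (σ * c) (w q) s) := by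
      intro s hs
      have := hloc (s - b) ⟨by linarith [hs.1], by linarith [hs.2]⟩
      rw [hwb, ← (helix_add hk q (w q) b (s - b)).1, ← (helix_add hk q (w q) b (s - b)).2,
        add_sub_cancel, ← hG] at this
      refine ⟨h.mem_regularPart this.1 this.2.1 this.2.2.1, ?_⟩
      rw [← h.field _ this.1 this.2.1 this.2.2.1, this.2.2.2]
    have hext' : ∀ s ∈ I' ∪ Ioo (b - ε) (b + ε), G s ∈ regularPart S ∧
        σ • e₁ (G s) = planarLift (G s) (rot (σ * c) (w q) s) := by
      rintro s (hs | hs)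
      exacts [hreg s hs, hext s hs]
    have hJ'conn : IsPreconnected (I' ∪ Ioo (b - ε) (b + ε)) := by
      obtain ⟨r, hr, hrε⟩ := (isGLB_lt_iff hglb).1 (show b < b + ε by linarith)
      exact IsPreconnected.union r hr ⟨by linarith [hglb.1 hr], hrε⟩ hI'ord.isPreconnected
        isPreconnected_Ioo
    have hJeq := hγ.maximal ((fun t => σ * (t - t₀)) ⁻¹' (I' ∪ Ioo (b - ε) (b + ε)))
      (fun t => G (σ * (t - t₀)))
      ((hI'open.union isOpen_Ioo).preimage (by fun_prop))
      (by
        have := hJ'conn.image (fun s => t₀ + σ * s) (by fun_prop)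
        rw [Set.image_eq_preimage_of_inverse (g := fun t => σ * (t - t₀)) hlin hlin'] at this
        exact this.ordConnected)
      (fun t ht => by
        obtain ⟨h1, h2⟩ := hext' _ ht
        refine ⟨h1, ?_⟩
        have hd : HasDerivAt (fun t => σ * (t - t₀)) σ t := by
          simpa using ((hasDerivAt_id t).sub_const t₀).const_mul σ
        have := (hasDerivAt_helix hk q (w q) (σ * (t - t₀))).scomp t hd
        rw [← hG, ← h2, smul_smul, hσ2, one_smul] at this
        exact this)
      (fun t ht => Or.inl (by simpa [hI', hlin'] using ht))
      (fun t ht => (hγG t ht).1.symm)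
    have : t₀ + σ * b ∈ I := by
      rw [← hJeq]
      exact Or.inr (by simp only [hlin]; constructor <;> linarith)
    exact hbI this
  refine ⟨t₀ + σ * b, G b, ?_, hbΓ, ?_⟩
  · rcases h.sign with hσ | hσ
    · right
      refine ⟨fun t ht => ?_, fun y hy => ?_⟩
      · have := hglb.1 (show t - t₀ ∈ I' by simpa [hI', hσ] using ht)
        rw [hσ]; linarith
      · have : y - t₀ ≤ b := hglb.2 fun s hs => by
          have := hy (show t₀ + s ∈ I by simpa [hI', hσ] using hs)
          linarith
        rw [hσ]; linarith
    · left
      refine ⟨fun t ht => ?_, fun y hy => ?_⟩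
      · have := hglb.1 (show t₀ - t ∈ I' by simpa [hI', hσ] using ht)
        rw [hσ]; linarith
      · have : t₀ - y ≤ b := hglb.2 fun s hs => by
          have := hy (show t₀ - s ∈ I by simpa [hI', hσ, sub_eq_add_neg] using hs)
          linarith
        rw [hσ]; linarith
  · have hsm : ContDiff ℝ ∞ (fun t => G (σ * (t - t₀))) := hGsm.comp (by fun_prop)
    refine hsm.contDiffOn.congr fun t ht => ?_
    by_cases htb : t = t₀ + σ * b
    · rw [htb, Function.update_self, hlin]
    · rw [Function.update_of_ne htb]
      exact (hγG t (ht.resolve_left htb)).1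

end IsSideModel

/-! ### Charts adapted to a singular curve -/

/-- The derivative of `f` along the left invariant field `frameX`. -/
noncomputable def derivX (f : H1 → ℝ) (p : H1) : ℝ := fderiv ℝ f p (frameX p)

/-- The derivative of `f` along the left invariant field `frameY`. -/
noncomputable def derivY (f : H1 → ℝ) (p : H1) : ℝ := fderiv ℝ f p (frameY p)

theorem planarLift_eq_frame (p : H1) (v : ℝ × ℝ) :
    planarLift p v = v.1 • frameX p + v.2 • frameY p := by
  funext i
  fin_cases i <;> simp [planarLift, frameX, frameY]
  ring

theorem fderiv_planarLift (f : H1 → ℝ) (p : H1) (v : ℝ × ℝ) :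
    fderiv ℝ f p (planarLift p v) = v.1 * derivX f p + v.2 * derivY f p := by
  simp [planarLift_eq_frame, derivX, derivY]

theorem contDiff_frameX {n : WithTop ℕ∞} : ContDiff ℝ n frameX := by
  refine contDiff_pi.2 fun i => ?_
  fin_cases i <;> simp [frameX] <;> fun_prop

theorem contDiff_frameY {n : WithTop ℕ∞} : ContDiff ℝ n frameY := by
  refine contDiff_pi.2 fun i => ?_
  fin_cases i <;> simp [frameY] <;> fun_prop

theorem ContDiffOn.derivX {f : H1 → ℝ} {U : Set H1} {n m : WithTop ℕ∞}
    (hf : ContDiffOn ℝ n f U) (hU : IsOpen U) (h : m + 1 ≤ n) : ContDiffOn ℝ m (derivX f) U :=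
  (hf.fderiv_of_isOpen hU h).clm_apply contDiff_frameX.contDiffOn

theorem ContDiffOn.derivY {f : H1 → ℝ} {U : Set H1} {n m : WithTop ℕ∞}
    (hf : ContDiffOn ℝ n f U) (hU : IsOpen U) (h : m + 1 ≤ n) : ContDiffOn ℝ m (derivY f) U :=
  (hf.fderiv_of_isOpen hU h).clm_apply contDiff_frameY.contDiffOn

/-- The commutator relation `[frameX, frameY] = -2 T`, applied to a function. -/
theorem fderiv_derivY_sub_fderiv_derivX {f : H1 → ℝ} {p : H1} (hf : ContDiffAt ℝ 2 f p) :
    fderiv ℝ (derivY f) p (frameX p) - fderiv ℝ (derivX f) p (frameY p) =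
      -2 * fderiv ℝ f p (frameT p) := by
  have hd : DifferentiableAt ℝ (fderiv ℝ f) p :=
    (hf.fderiv_right (m := 1) (by norm_num)).differentiableAt (by norm_num)
  have hX : HasFDerivAt frameX (fderiv ℝ frameX p) p :=
    (contDiff_frameX (n := 1)).contDiffAt.differentiableAt (by norm_num) |>.hasFDerivAt
  have hY : HasFDerivAt frameY (fderiv ℝ frameY p) p :=
    (contDiff_frameY (n := 1)).contDiffAt.differentiableAt (by norm_num) |>.hasFDerivAt
  have eX : fderiv ℝ frameX p (frameY p) = frameT p := by
    have h1 : HasDerivAt (fun t : ℝ => frameX (p + t • frameY p))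
        (fderiv ℝ frameX p (frameY p)) 0 := hX.hasLineDerivAt (frameY p)
    have h2 : HasDerivAt (fun t : ℝ => frameX (p + t • frameY p)) (frameT p) 0 := by
      refine hasDerivAt_pi.2 fun i => ?_
      fin_cases i <;> simp [frameX, frameY, frameT]
      · exact hasDerivAt_const _ _
      · exact hasDerivAt_const _ _
      · exact (hasDerivAt_id (0 : ℝ)).const_add (p 1)
    exact h1.unique h2
  have eY : fderiv ℝ frameY p (frameX p) = -frameT p := by
    have h1 : HasDerivAt (fun t : ℝ => frameY (p + t • frameX p))
        (fderiv ℝ frameY p (frameX p)) 0 := hY.hasLineDerivAt (frameX p)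
    have h2 : HasDerivAt (fun t : ℝ => frameY (p + t • frameX p)) (-frameT p) 0 := by
      refine hasDerivAt_pi.2 fun i => ?_
      fin_cases i <;> simp [frameX, frameY, frameT]
      · exact hasDerivAt_const _ _
      · exact hasDerivAt_const _ _
      · simpa using ((hasDerivAt_id (0 : ℝ)).add_const (p 0)).fun_neg
    exact h1.unique h2
  have h1 : fderiv ℝ (derivX f) p (frameY p) =
      fderiv ℝ (fderiv ℝ f) p (frameY p) (frameX p) + fderiv ℝ f p (frameT p) := by
    have := (hd.hasFDerivAt.clm_apply hX).fderiv
    rw [show derivX f = fun q => fderiv ℝ f q (frameX q) from rfl, this]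
    simp [eX, add_comm]
  have h2 : fderiv ℝ (derivY f) p (frameX p) =
      fderiv ℝ (fderiv ℝ f) p (frameX p) (frameY p) - fderiv ℝ f p (frameT p) := by
    have := (hd.hasFDerivAt.clm_apply hY).fderiv
    rw [show derivY f = fun q => fderiv ℝ f q (frameY q) from rfl, this]
    simp [eY, sub_eq_neg_add]
  have hsymm : IsSymmSndFDerivAt ℝ f p := hf.isSymmSndFDerivAt (by simp)
  rw [h1, h2, hsymm.eq]
  ring

theorem fderiv_eq_zero_of_mem_tangentPlane {S U : Set H1} {f : H1 → ℝ} (hU : IsOpen U)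
    (hS : ∀ q ∈ U, q ∈ S ↔ f q = 0) {p v : H1} (hp : p ∈ U) (hf : DifferentiableAt ℝ f p)
    (hv : v ∈ tangentPlane S p) : fderiv ℝ f p v = 0 := by
  obtain ⟨γ, h0, hγS, hγ⟩ := hv
  have h1 : HasDerivAt (fun t => f (γ t)) (fderiv ℝ f p v) 0 := by
    rw [← h0] at hf ⊢
    exact hf.hasFDerivAt.comp_hasDerivAt (0 : ℝ) hγ
  have h2 : (fun t => f (γ t)) =ᶠ[𝓝 0] fun _ => 0 := by
    have : ∀ᶠ t in 𝓝 (0 : ℝ), γ t ∈ U := hγ.continuousAt (hU.mem_nhds (h0 ▸ hp))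
    filter_upwards [hγS, this] with t ht1 ht2 using (hS _ ht2).1 ht1
  exact h1.unique ((hasDerivAt_const (0 : ℝ) (0 : ℝ)).congr_of_eventuallyEq h2)

theorem derivX_derivY_eq_zero_of_singular {S U : Set H1} {f : H1 → ℝ} (hU : IsOpen U)
    (hS : ∀ q ∈ U, q ∈ S ↔ f q = 0) {p : H1} (hp : p ∈ U) (hf : DifferentiableAt ℝ f p)
    (hs : p ∈ singularSet S) : derivX f p = 0 ∧ derivY f p = 0 := by
  refine ⟨fderiv_eq_zero_of_mem_tangentPlane hU hS hp hf ?_,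
    fderiv_eq_zero_of_mem_tangentPlane hU hS hp hf ?_⟩ <;> rw [hs.2]
  · show contactForm p (frameX p) = 0
    simp [contactForm, frameX]
  · show contactForm p (frameY p) = 0
    simp [contactForm, frameY]

/-- The inverse function theorem, for a linear coordinate `ℓ` and two functions `α` and `f`. -/
theorem exists_adapted_chart {ℓ : H1 →L[ℝ] ℝ} {α f : H1 → ℝ} {α' f' : H1 →L[ℝ] ℝ} {p₀ : H1}
    (hα : HasStrictFDerivAt α α' p₀) (hf : HasStrictFDerivAt f f' p₀)
    (hinj : ∀ v, ℓ v = 0 → α' v = 0 → f' v = 0 → v = 0) :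
    ∃ e : OpenPartialHomeomorph H1 H1, p₀ ∈ e.source ∧ (∀ q, e q = ![ℓ q, α q, f q]) ∧
      ∃ L : H1 ≃L[ℝ] H1, (∀ v, L v = ![ℓ v, α' v, f' v]) ∧
        HasStrictFDerivAt e.symm (L.symm : H1 →L[ℝ] H1) (e p₀) := by
  set L₀ : H1 →L[ℝ] H1 := ContinuousLinearMap.pi ![ℓ, α', f'] with hL₀
  have hL₀v : ∀ v, L₀ v = ![ℓ v, α' v, f' v] := fun v => by
    funext i
    fin_cases i <;> simp [hL₀]
  have hker : Function.Injective (L₀ : H1 →ₗ[ℝ] H1) := by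
    rw [← LinearMap.ker_eq_bot, LinearMap.ker_eq_bot']
    intro v hv
    have hv' : ![ℓ v, α' v, f' v] = 0 := by rw [← hL₀v]; exact hv
    exact hinj v (by simpa using congrFun hv' 0) (by simpa using congrFun hv' 1)
      (by simpa using congrFun hv' 2)
  set L : H1 ≃L[ℝ] H1 :=
    (LinearEquiv.ofInjectiveEndo (L₀ : H1 →ₗ[ℝ] H1) hker).toContinuousLinearEquiv with hL
  have hLv : ∀ v, L v = L₀ v := fun v => rfl
  have hΦ : HasStrictFDerivAt (fun q => (![ℓ q, α q, f q] : H1)) (L : H1 →L[ℝ] H1) p₀ := by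
    have : (L : H1 →L[ℝ] H1) = L₀ := by ext v : 1; exact hLv v
    rw [this, hasStrictFDerivAt_pi']
    intro i
    fin_cases i
    · exact ℓ.hasStrictFDerivAt
    · exact hα
    · exact hf
  refine ⟨hΦ.toOpenPartialHomeomorph _, hΦ.mem_toOpenPartialHomeomorph_source,
    fun q => by rw [hΦ.toOpenPartialHomeomorph_coe], L, fun v => (hLv v).trans (hL₀v v), ?_⟩
  exact hΦ.to_localInverse

section AdaptedChart

variable {ℓ : H1 →L[ℝ] ℝ} {α f : H1 → ℝ} {α' f' : H1 →L[ℝ] ℝ} {p₀ : H1}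
  {e : OpenPartialHomeomorph H1 H1} {L : H1 ≃L[ℝ] H1}

/-- A function `h` that vanishes on the curve `{α = 0, f = 0}` is a multiple of `α` on `{f = 0}`
to first order; the factor is continuous up to the curve. -/
theorem exists_tendsto_div (hp₀ : p₀ ∈ e.source) (he : ∀ q, e q = ![ℓ q, α q, f q])
    (hL : ∀ v, L v = ![ℓ v, α' v, f' v])
    (hψ : HasStrictFDerivAt e.symm (L.symm : H1 →L[ℝ] H1) (e p₀)) (hα0 : α p₀ = 0)
    (hf0 : f p₀ = 0) {h : H1 → ℝ} {h' : H1 →L[ℝ] ℝ} (hh : HasStrictFDerivAt h h' p₀)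
    (hz : ∀ᶠ P in 𝓝 (e p₀), P 1 = 0 → P 2 = 0 → h (e.symm P) = 0) :
    ∃ a : ℝ, Tendsto (fun q => h q / α q) (𝓝[{q | f q = 0 ∧ α q ≠ 0}] p₀) (𝓝 a) ∧
      ∀ v, f' v = 0 → h' v = α' v * a := by
  have hleft : e.symm (e p₀) = p₀ := e.left_inv hp₀
  have hcomp : HasStrictFDerivAt (fun P => h (e.symm P))
      (h'.comp (L.symm : H1 →L[ℝ] H1)) (e p₀) := by
    rw [← hleft] at hh
    exact hh.comp (e p₀) hψ
  have hP1 : e p₀ 1 = 0 := by simp [he, hα0]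
  have hP2 : e p₀ 2 = 0 := by simp [he, hf0]
  refine ⟨h' (L.symm (Pi.single 1 1)), ?_, ?_⟩
  · have hcont : Tendsto e (𝓝 p₀) (𝓝 (e p₀)) := e.continuousAt hp₀
    have hproj : Tendsto (fun q => (![ℓ q, 0, f q] : H1)) (𝓝 p₀) (𝓝 (e p₀)) := by
      have : Tendsto (fun P : H1 => (![P 0, 0, P 2] : H1)) (𝓝 (e p₀)) (𝓝 (e p₀)) := by
        have hc : Continuous (fun P : H1 => (![P 0, 0, P 2] : H1)) := by
          refine continuous_pi fun i => ?_
          fin_cases i <;> simp <;> fun_prop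
        have h2 : (![e p₀ 0, 0, e p₀ 2] : H1) = e p₀ := by
          funext i
          fin_cases i <;> simp [hP1]
        simpa only [h2] using hc.tendsto (e p₀)
      refine (this.comp hcont).congr fun q => ?_
      simp [he]
    have hO := (hcomp.isLittleO.comp_tendsto (hcont.prodMk_nhds hproj)).mono
      (nhdsWithin_le_nhds (s := {q | f q = 0 ∧ α q ≠ 0}))
    have hdiff : ∀ q, e q - ![ℓ q, 0, f q] = α q • (Pi.single 1 1 : H1) := fun q => by
      rw [he]
      funext i
      fin_cases i <;> simp
    have hO2 : (fun q => h q - α q * h' (L.symm (Pi.single 1 1)))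
        =o[𝓝[{q | f q = 0 ∧ α q ≠ 0}] p₀] α := by
      have hbig : (fun q => e q - ![ℓ q, 0, f q]) =O[𝓝[{q | f q = 0 ∧ α q ≠ 0}] p₀] α := by
        refine Asymptotics.IsBigO.of_bound 1 (.of_forall fun q => ?_)
        rw [hdiff, norm_smul, Pi.norm_single]
        simp
      refine (hO.congr' ?_ .rfl).trans_isBigO hbig
      have hsrc : e.source ∈ 𝓝[{q | f q = 0 ∧ α q ≠ 0}] p₀ :=
        mem_nhdsWithin_of_mem_nhds (e.open_source.mem_nhds hp₀)
      filter_upwards [hsrc, self_mem_nhdsWithin,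
        mem_nhdsWithin_of_mem_nhds (hproj.eventually hz)] with q hq1 hq2 hq3
      have hq4 := hq3 (by simp) (by simpa using hq2.1)
      simp only [Function.comp_apply, hdiff, e.left_inv hq1, hq4]
      simp
    have := hO2.tendsto_div_nhds_zero.add_const (h' (L.symm (Pi.single 1 1)))
    rw [zero_add] at this
    refine this.congr' ?_
    filter_upwards [self_mem_nhdsWithin] with q hq
    have hq' : α q ≠ 0 := hq.2
    field_simp
    ring
  · intro v hv
    have hτ : h' (L.symm (Pi.single 0 1)) = 0 := by
      have h1 : HasDerivAt (fun t : ℝ => h (e.symm (e p₀ + t • (Pi.single 0 1 : H1))))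
          (h' (L.symm (Pi.single 0 1))) 0 := hcomp.hasFDerivAt.hasLineDerivAt (Pi.single 0 1)
      have htend : Tendsto (fun t : ℝ => e p₀ + t • (Pi.single 0 1 : H1)) (𝓝 0) (𝓝 (e p₀)) := by
        have : Continuous (fun t : ℝ => e p₀ + t • (Pi.single 0 1 : H1)) := by fun_prop
        simpa using this.tendsto 0
      have h2 : (fun t : ℝ => h (e.symm (e p₀ + t • (Pi.single 0 1 : H1)))) =ᶠ[𝓝 0]
          fun _ => 0 := by
        filter_upwards [htend.eventually hz] with t ht
        exact ht (by simp [hP1]) (by simp [hP2])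
      exact h1.unique ((hasDerivAt_const (0 : ℝ) (0 : ℝ)).congr_of_eventuallyEq h2)
    have hv' : v = ℓ v • L.symm (Pi.single 0 1) + α' v • L.symm (Pi.single 1 1) := by
      apply L.injective
      rw [map_add, map_smul, map_smul, L.apply_symm_apply, L.apply_symm_apply, hL]
      funext i
      fin_cases i <;> simp [hv]
    conv_lhs => rw [hv']
    rw [map_add, map_smul, map_smul, hτ]
    simp

theorem chart_symm_apply (he : ∀ q, e q = ![ℓ q, α q, f q]) {P : H1} (hP : P ∈ e.target) :
    α (e.symm P) = P 1 ∧ f (e.symm P) = P 2 := by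
  have h := e.right_inv hP
  rw [he] at h
  exact ⟨congrFun h 1, congrFun h 2⟩

/-- The sides `0 < ρ * α` of the curve in the surface `{f = 0}` are connected near `p₀`. -/
theorem exists_isPreconnected_side (hp₀ : p₀ ∈ e.source) (he : ∀ q, e q = ![ℓ q, α q, f q])
    {U : Set H1} (hU : U ∈ 𝓝 p₀) :
    ∃ V ⊆ U, IsOpen V ∧ p₀ ∈ V ∧ ∀ ρ : ℝ, IsPreconnected {q | q ∈ V ∧ f q = 0 ∧ 0 < ρ * α q} := by
  have hU' : e.target ∩ e.symm ⁻¹' U ∈ 𝓝 (e p₀) :=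
    inter_mem (e.open_target.mem_nhds (e.map_source hp₀))
      ((e.continuousAt_symm (e.map_source hp₀)).preimage_mem_nhds (by rwa [e.left_inv hp₀]))
  obtain ⟨r, hr, hball⟩ := Metric.mem_nhds_iff.1 hU'
  refine ⟨e.source ∩ e ⁻¹' Metric.ball (e p₀) r, fun q hq => ?_,
    e.isOpen_inter_preimage Metric.isOpen_ball, ⟨hp₀, Metric.mem_ball_self hr⟩, fun ρ => ?_⟩
  · have := (hball hq.2).2
    rwa [mem_preimage, e.left_inv hq.1] at this
  · have hconv : Convex ℝ (Metric.ball (e p₀) r ∩ {P : H1 | 0 < ρ * P 1} ∩ {P | P 2 = 0}) := by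
      refine ((convex_ball _ _).inter ?_).inter ?_
      · exact convex_halfSpace_gt (f := fun P : H1 => ρ * P 1)
          ⟨fun x y => by simp; ring, fun a x => by simp; ring⟩ 0
      · exact convex_hyperplane (f := fun P : H1 => P 2)
          ⟨fun x y => by simp, fun a x => by simp⟩ 0
    have himg := hconv.isPreconnected.image e.symm
      (e.continuousOn_symm.mono fun P hP => (hball hP.1.1).1)
    convert himg using 1
    ext q
    constructor
    · rintro ⟨⟨h1, h2⟩, h3, h4⟩
      exact ⟨e q, ⟨⟨h2, by simpa [he] using h4⟩, by simpa [he] using h3⟩, e.left_inv h1⟩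
    · rintro ⟨P, ⟨⟨h1, h2⟩, h3⟩, rfl⟩
      have ht := (hball h1).1
      have hP := e.right_inv ht
      obtain ⟨hα, hf⟩ := chart_symm_apply he ht
      refine ⟨⟨e.map_target ht, ?_⟩, hf.trans h3, ?_⟩
      · rwa [mem_preimage, hP]
      · rw [hα]; exact h2

theorem neBot_side (hp₀ : p₀ ∈ e.source) (he : ∀ q, e q = ![ℓ q, α q, f q]) (hα0 : α p₀ = 0)
    (hf0 : f p₀ = 0) {ρ : ℝ} (hρ : ρ ≠ 0) :
    (𝓝[{q | f q = 0 ∧ 0 < ρ * α q}] p₀).NeBot := by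
  have hcurve : Tendsto (fun t : ℝ => e p₀ + (t * ρ) • (Pi.single 1 1 : H1)) (𝓝[>] 0)
      (𝓝 (e p₀)) := by
    have : Continuous (fun t : ℝ => e p₀ + (t * ρ) • (Pi.single 1 1 : H1)) := by fun_prop
    simpa using (this.tendsto 0).mono_left nhdsWithin_le_nhds
  have hlim : Tendsto (fun t : ℝ => e.symm (e p₀ + (t * ρ) • (Pi.single 1 1 : H1))) (𝓝[>] 0)
      (𝓝[{q | f q = 0 ∧ 0 < ρ * α q}] p₀) := by
    refine tendsto_nhdsWithin_iff.2 ⟨?_, ?_⟩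
    · have := (e.continuousAt_symm (e.map_source hp₀)).tendsto.comp hcurve
      rwa [e.left_inv hp₀] at this
    · filter_upwards [hcurve (e.open_target.mem_nhds (e.map_source hp₀)), self_mem_nhdsWithin]
        with t ht ht0
      rw [mem_preimage] at ht
      refine ⟨(chart_symm_apply he ht).2.trans (by simp [he, hf0]), ?_⟩
      rw [(chart_symm_apply he ht).1]
      have h1 : (e p₀ + (t * ρ) • (Pi.single 1 1 : H1)) 1 = t * ρ := by simp [he, hα0]
      rw [h1]
      have h2 := mul_pos (show 0 < t from ht0) (mul_self_pos.2 hρ)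
      linarith
  exact hlim.neBot

/-- An injective arc in the curve `{α = 0, f = 0}` through `p₀` fills the curve near `p₀`. -/
theorem eventually_mem_of_arc (hp₀ : p₀ ∈ e.source) (he : ∀ q, e q = ![ℓ q, α q, f q])
    {Γ N : Set H1} (hN : N ∈ 𝓝 p₀) (hΓ : ∀ q ∈ N, q ∈ Γ → α q = 0 ∧ f q = 0) {η : ℝ → H1}
    (hη0 : η 0 = p₀) (hηc : ContinuousOn η (Ioo (-1) 1)) (hηi : InjOn η (Ioo (-1) 1))
    (hηΓ : MapsTo η (Ioo (-1) 1) Γ) :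
    ∀ᶠ q in 𝓝 p₀, α q = 0 → f q = 0 → q ∈ Γ := by
  have h01 : Ioo (-1 : ℝ) 1 ∈ 𝓝 (0 : ℝ) := Ioo_mem_nhds (by norm_num) (by norm_num)
  have hev : ∀ᶠ t in 𝓝 (0 : ℝ), t ∈ Ioo (-1 : ℝ) 1 ∧ η t ∈ e.source ∩ N := by
    refine Filter.Eventually.and h01 ?_
    have := (hηc 0 ⟨by norm_num, by norm_num⟩).continuousAt h01
    rw [ContinuousAt, hη0] at this
    exact this (inter_mem (e.open_source.mem_nhds hp₀) hN)
  obtain ⟨δ, hδ, hball⟩ := Metric.eventually_nhds_iff.1 hev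
  have hin : ∀ t ∈ Ioo (-δ) δ, t ∈ Ioo (-1 : ℝ) 1 ∧ η t ∈ e.source ∩ N := fun t ht =>
    hball (by rw [Real.dist_eq, sub_zero]; exact abs_lt.2 ht)
  have hzero : ∀ t ∈ Ioo (-δ) δ, α (η t) = 0 ∧ f (η t) = 0 := fun t ht =>
    hΓ _ (hin t ht).2.2 (hηΓ (hin t ht).1)
  have hinj : ∀ q ∈ e.source, ∀ q' ∈ e.source, ℓ q = ℓ q' → α q = 0 → f q = 0 → α q' = 0 →
      f q' = 0 → q = q' := fun q hq q' hq' h1 h2 h3 h4 h5 =>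
    e.injOn hq hq' (by rw [he, he, h1, h2, h3, h4, h5])
  have hgc : ContinuousOn (fun t => ℓ (η t)) (Ioo (-δ) δ) :=
    ℓ.continuous.comp_continuousOn (hηc.mono fun t ht => (hin t ht).1)
  have hgi : InjOn (fun t => ℓ (η t)) (Ioo (-δ) δ) := fun s hs t ht hst =>
    hηi (hin s hs).1 (hin t ht).1 (hinj _ (hin s hs).2.1 _ (hin t ht).2.1 hst
      (hzero s hs).1 (hzero s hs).2 (hzero t ht).1 (hzero t ht).2)
  have hm1 : -(δ / 2) ∈ Ioo (-δ) δ := ⟨by linarith, by linarith⟩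
  have hm2 : δ / 2 ∈ Ioo (-δ) δ := ⟨by linarith, by linarith⟩
  have hm0 : (0 : ℝ) ∈ Ioo (-δ) δ := ⟨by linarith, by linarith⟩
  have himage : ℓ '' (η '' Ioo (-δ) δ) ∈ 𝓝 (ℓ p₀) := by
    have hsub : uIcc (-(δ / 2)) (δ / 2) ⊆ Ioo (-δ) δ := by
      rw [uIcc_of_le (by linarith)]
      exact fun t ht => ⟨by linarith [ht.1], by linarith [ht.2]⟩
    have hivt := intermediate_value_uIcc (hgc.mono hsub)
    have hnb : uIcc (ℓ (η (-(δ / 2)))) (ℓ (η (δ / 2))) ∈ 𝓝 (ℓ p₀) := by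
      rw [← hη0]
      rcases hgc.strictMonoOn_of_injOn_Ioo (by linarith) hgi with hmono | hanti
      · have h1 := hmono hm1 hm0 (by linarith)
        have h2 := hmono hm0 hm2 (by linarith)
        rw [uIcc_of_le (h1.trans h2).le]
        exact Icc_mem_nhds h1 h2
      · have h1 := hanti hm1 hm0 (by linarith)
        have h2 := hanti hm0 hm2 (by linarith)
        rw [uIcc_of_ge (h2.trans h1).le]
        exact Icc_mem_nhds h2 h1
    refine mem_of_superset hnb (hivt.trans ?_)
    rintro _ ⟨t, ht, rfl⟩
    exact ⟨η t, ⟨t, hsub ht, rfl⟩, rfl⟩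
  filter_upwards [ℓ.continuous.continuousAt himage, e.open_source.mem_nhds hp₀]
    with q hq1 hq2 hq3 hq4
  obtain ⟨_, ⟨t, ht, rfl⟩, hqt⟩ := hq1
  rw [hinj q hq2 (η t) (hin t ht).2.1 hqt.symm hq3 hq4 (hzero t ht).1 (hzero t ht).2]
  exact hηΓ (hin t ht).1

end AdaptedChart

/-! ### The two sides of a singular curve -/

/-- `U` and `f` present `S` as a surface of class `C^n` near the singular point `p₀`, with `f`
oriented so that it decreases in the direction of `T` at `p₀`. -/
structure IsOrientedPresentation (n : WithTop ℕ∞) (S : Set H1) (p₀ : H1) (U : Set H1)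
    (f : H1 → ℝ) : Prop where
  isOpen : IsOpen U
  mem : p₀ ∈ U
  contDiffOn : ContDiffOn ℝ n f U
  surface : ∀ q ∈ U, q ∈ S ↔ f q = 0
  singular : p₀ ∈ singularSet S
  orient : fderiv ℝ f p₀ (frameT p₀) < 0

theorem exists_orientedPresentation {n : WithTop ℕ∞} (hn : 1 ≤ n) {S : Set H1} {p₀ : H1}
    (hS : IsSurfaceAt n S p₀) (hp₀ : p₀ ∈ singularSet S) :
    ∃ U f, IsOrientedPresentation n S p₀ U f := by
  obtain ⟨U, f, hU, hpU, hf, hne, hSf⟩ := hS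
  have hd : DifferentiableAt ℝ f p₀ :=
    (hf.contDiffAt (hU.mem_nhds hpU)).differentiableAt (by rintro rfl; norm_num at hn)
  obtain ⟨hX, hY⟩ := derivX_derivY_eq_zero_of_singular hU hSf hpU hd hp₀
  have hT : fderiv ℝ f p₀ (frameT p₀) ≠ 0 := by
    intro hT
    refine hne p₀ hpU (ContinuousLinearMap.ext fun v => ?_)
    rw [frameCoord_spec p₀ v, map_add, map_add, map_smul, map_smul, map_smul, hT]
    unfold derivX at hX
    unfold derivY at hY
    simp [hX, hY]
  rcases hT.lt_or_gt with h | h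
  · exact ⟨U, f, hU, hpU, hf, hSf, hp₀, h⟩
  · refine ⟨U, fun q => -f q, hU, hpU, hf.neg, fun q hq => by rw [hSf q hq, neg_eq_zero],
      hp₀, ?_⟩
    rw [fderiv_fun_neg]
    simpa using h

/-- The planar components of the unit characteristic field `(Yf) X - (Xf) Y`, normalized, of the
level surfaces of `f`. -/
noncomputable def charDir (f : H1 → ℝ) (q : H1) : ℝ × ℝ :=
  (derivY f q / √(derivX f q ^ 2 + derivY f q ^ 2),
    -derivX f q / √(derivX f q ^ 2 + derivY f q ^ 2))

theorem sq_add_sq_pos {a b : ℝ} (h : ¬(a = 0 ∧ b = 0)) : 0 < a ^ 2 + b ^ 2 := by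
  rcases not_and_or.1 h with h | h <;> have := sq_pos_of_ne_zero h <;>
    nlinarith [sq_nonneg a, sq_nonneg b]

theorem charDir_unit {f : H1 → ℝ} {q : H1} (h : ¬(derivX f q = 0 ∧ derivY f q = 0)) :
    (charDir f q).1 ^ 2 + (charDir f q).2 ^ 2 = 1 := by
  have hpos := sq_add_sq_pos h
  simp only [charDir, div_pow, Real.sq_sqrt hpos.le, neg_sq]
  field_simp
  ring

theorem fderiv_charDir (f : H1 → ℝ) (q : H1) :
    fderiv ℝ f q (planarLift q (charDir f q)) = 0 := by
  rw [fderiv_planarLift]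
  simp only [charDir]
  ring

theorem contDiffAt_charDir {f : H1 → ℝ} {q : H1} (hX : ContDiffAt ℝ 1 (derivX f) q)
    (hY : ContDiffAt ℝ 1 (derivY f) q) (h : ¬(derivX f q = 0 ∧ derivY f q = 0)) :
    ContDiffAt ℝ 1 (charDir f) q := by
  have hpos := sq_add_sq_pos h
  have hs := ((hX.pow 2).add (hY.pow 2)).sqrt hpos.ne'
  have hs0 := (Real.sqrt_pos.2 hpos).ne'
  exact (hY.div hs hs0).prodMk (hX.neg.div hs hs0)

/-- `charDir` is the only unit direction in the contact plane that is tangent to the surface, up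
to sign. -/
theorem inner_charDir_sq {f : H1 → ℝ} {q : H1} (h : ¬(derivX f q = 0 ∧ derivY f q = 0))
    {v : ℝ × ℝ} (hv : v.1 ^ 2 + v.2 ^ 2 = 1) (htan : v.1 * derivX f q + v.2 * derivY f q = 0) :
    (v.1 * (charDir f q).1 + v.2 * (charDir f q).2) ^ 2 = 1 := by
  have hpos := sq_add_sq_pos h
  have hs := Real.sq_sqrt hpos.le
  have hs0 := (Real.sqrt_pos.2 hpos).ne'
  simp only [charDir]
  field_simp
  rw [hs]
  linear_combination (derivX f q ^ 2 + derivY f q ^ 2) * hv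
    - (v.1 * derivX f q + v.2 * derivY f q) * htan

theorem eq_smul_of_inner_eq {u v : ℝ × ℝ} {σ : ℝ} (hσ : σ * σ = 1) (hu : u.1 ^ 2 + u.2 ^ 2 = 1)
    (hv : v.1 ^ 2 + v.2 ^ 2 = 1) (h : v.1 * u.1 + v.2 * u.2 = σ) : u = σ • v := by
  have hsum : (u.1 - σ * v.1) ^ 2 + (u.2 - σ * v.2) ^ 2 = 0 := by
    linear_combination hu + σ * σ * hv - 2 * σ * h - hσ
  have h1 : u.1 - σ * v.1 = 0 := by nlinarith [sq_nonneg (u.1 - σ * v.1), sq_nonneg (u.2 - σ * v.2)]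
  have h2 : u.2 - σ * v.2 = 0 := by nlinarith [sq_nonneg (u.1 - σ * v.1), sq_nonneg (u.2 - σ * v.2)]
  exact Prod.ext (by simpa [sub_eq_zero] using h1) (by simpa [sub_eq_zero] using h2)

/-- Near `p₀`, the surface consists of the singular curve `Γ = {α = 0}` and of two sides
`0 < ρ * α`, `ρ = ±1`, which are both described by the direction field `charDir f`, with opposite
limits `ρ • m` at `p₀`. The last two fields describe the second derivatives of `f` at `p₀` in the
directions of `m` and of `J m`. -/
structure IsTwoSidedModel (S Γ : Set H1) (e₁ : H1 → H1) (f α : H1 → ℝ) (m : ℝ × ℝ) (κ : ℝ)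
    (p₀ : H1) (R : Set H1) : Prop where
  side : ∀ ρ : ℝ, ρ = 1 ∨ ρ = -1 →
    ∃ σ, IsSideModel S Γ e₁ σ κ f (fun q => ρ * α q) (charDir f) (ρ • m) p₀ R
  connected : ∀ V ∈ 𝓝 p₀, ∃ V' ⊆ V, V' ∈ 𝓝 p₀ ∧
    ∀ ρ : ℝ, IsPreconnected {q | q ∈ V' ∧ q ∈ S ∧ 0 < ρ * α q}
  unit : m.1 ^ 2 + m.2 ^ 2 = 1
  second_m : m.1 * fderiv ℝ (derivX f) p₀ (planarLift p₀ (-m.2, m.1))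
    + m.2 * fderiv ℝ (derivY f) p₀ (planarLift p₀ (-m.2, m.1)) = 0
  second_Jm : -m.2 * fderiv ℝ (derivX f) p₀ (planarLift p₀ m)
    + m.1 * fderiv ℝ (derivY f) p₀ (planarLift p₀ m) ≠ 0

/-- The structure of the surface near a singular curve. Let `A = Xf` and `B = Yf`. One of them is
a defining function `α` of `Γ` in `S`, because `XB - YA = -2 Tf` does not vanish. The
quotients `A / α` and `B / α` have limits, hence so does the direction field on either side, and
the limits on the two sides are opposite. The derivative of `α` in the limit direction is
`-2 Tf / |(A / α, B / α)|`, so the leaves are transverse to `Γ`. -/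
theorem exists_twoSidedModel {S Γ : Set H1} {e₁ : H1 → H1} {c : ℝ} {p₀ : H1} {U : Set H1}
    {f : H1 → ℝ} (hS : IsConstantPMeanCurvatureSurface S e₁ c) (hΓ : IsSingularCurve S Γ)
    (hp₀ : p₀ ∈ Γ) (hf : IsOrientedPresentation 2 S p₀ U f) :
    ∃ α m κ R, IsTwoSidedModel S Γ e₁ f α m κ p₀ R := by
  have hU := hf.isOpen
  have hA : ContDiffOn ℝ 1 (derivX f) U := hf.contDiffOn.derivX hU (by norm_num)
  have hB : ContDiffOn ℝ 1 (derivY f) U := hf.contDiffOn.derivY hU (by norm_num)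
  have hA' : ∀ q ∈ U, ContDiffAt ℝ 1 (derivX f) q := fun q hq => hA.contDiffAt (hU.mem_nhds hq)
  have hB' : ∀ q ∈ U, ContDiffAt ℝ 1 (derivY f) q := fun q hq => hB.contDiffAt (hU.mem_nhds hq)
  have hf' : ∀ q ∈ U, ContDiffAt ℝ 2 f q := fun q hq =>
    hf.contDiffOn.contDiffAt (hU.mem_nhds hq)
  have hfd : ∀ q ∈ U, DifferentiableAt ℝ f q := fun q hq =>
    (hf' q hq).differentiableAt (by norm_num)
  have hsing : ∀ q ∈ U, q ∈ singularSet S → derivX f q = 0 ∧ derivY f q = 0 := fun q hq hs =>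
    derivX_derivY_eq_zero_of_singular hU hf.surface hq (hfd q hq) hs
  obtain ⟨hA0, hB0⟩ := hsing p₀ hf.mem hf.singular
  have hf0 : f p₀ = 0 := (hf.surface p₀ hf.mem).1 hf.singular.1
  have hcomm := fderiv_derivY_sub_fderiv_derivX (hf' p₀ hf.mem)
  have hT := hf.orient
  set DA := fderiv ℝ (derivX f) p₀ with hDA
  set DB := fderiv ℝ (derivY f) p₀ with hDB
  have hAs : HasStrictFDerivAt (derivX f) DA p₀ :=
    (hA' p₀ hf.mem).hasStrictFDerivAt (by norm_num)
  have hBs : HasStrictFDerivAt (derivY f) DB p₀ :=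
    (hB' p₀ hf.mem).hasStrictFDerivAt (by norm_num)
  have hfs : HasStrictFDerivAt f (fderiv ℝ f p₀) p₀ :=
    (hf' p₀ hf.mem).hasStrictFDerivAt (by norm_num)
  have hker : ∀ v : H1, fderiv ℝ f p₀ v = 0 → v = v 0 • frameX p₀ + v 1 • frameY p₀ := by
    intro v hv
    have h1 := frameCoord_spec p₀ v
    have hv' := hv
    rw [h1, map_add, map_add, map_smul, map_smul, map_smul,
      show fderiv ℝ f p₀ (frameX p₀) = 0 from hA0, show fderiv ℝ f p₀ (frameY p₀) = 0 from hB0,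
      smul_zero, smul_zero, zero_add, zero_add, smul_eq_mul] at hv'
    rw [(mul_eq_zero.1 hv').resolve_right hT.ne, zero_smul, add_zero] at h1
    simpa [frameCoord] using h1
  -- the defining function `α` and the coordinate `ℓ`
  obtain ⟨α, ℓ, hαAB, hα1, hinj⟩ : ∃ (α : H1 → ℝ) (ℓ : H1 →L[ℝ] ℝ),
      (∀ q, derivX f q = 0 ∧ derivY f q = 0 → α q = 0) ∧ (∀ q ∈ U, ContDiffAt ℝ 1 α q) ∧
      ∀ v, ℓ v = 0 → fderiv ℝ α p₀ v = 0 → fderiv ℝ f p₀ v = 0 → v = 0 := by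
    by_cases hYA : DA (frameY p₀) = 0
    · have hXB : DB (frameX p₀) ≠ 0 := fun h0 => by
        rw [hYA, h0] at hcomm
        linarith
      refine ⟨derivY f, ContinuousLinearMap.proj 1, fun q hq => hq.2, hB', fun v h1 h2 h3 => ?_⟩
      have hv := hker v h3
      have h1' : v 1 = 0 := h1
      rw [h1', zero_smul, add_zero] at hv
      rw [hv, map_smul, smul_eq_mul] at h2
      rw [hv, (mul_eq_zero.1 h2).resolve_right hXB, zero_smul]
    · refine ⟨derivX f, ContinuousLinearMap.proj 0, fun q hq => hq.1, hA', fun v h1 h2 h3 => ?_⟩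
      have hv := hker v h3
      have h1' : v 0 = 0 := h1
      rw [h1', zero_smul, zero_add] at hv
      rw [hv, map_smul, smul_eq_mul] at h2
      rw [hv, (mul_eq_zero.1 h2).resolve_right hYA, zero_smul]
  have hαs : HasStrictFDerivAt α (fderiv ℝ α p₀) p₀ :=
    (hα1 p₀ hf.mem).hasStrictFDerivAt (by norm_num)
  have hα0 : α p₀ = 0 := hαAB p₀ ⟨hA0, hB0⟩
  obtain ⟨e, hpe, he, L, hL, hψ⟩ := exists_adapted_chart hαs hfs hinj
  obtain ⟨η, hη0, hηc, hηi, hηΓ⟩ := hΓ.arc p₀ hp₀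
  have hcurve : ∀ᶠ q in 𝓝 p₀, α q = 0 → f q = 0 → q ∈ Γ :=
    eventually_mem_of_arc hpe he (hU.mem_nhds hf.mem)
      (fun q hq hqΓ => ⟨hαAB q (hsing q hq (hΓ.subset hqΓ)),
        (hf.surface q hq).1 (hΓ.subset hqΓ).1⟩) hη0 hηc hηi hηΓ
  have hz : ∀ᶠ P in 𝓝 (e p₀), P 1 = 0 → P 2 = 0 →
      derivX f (e.symm P) = 0 ∧ derivY f (e.symm P) = 0 := by
    have ht := e.tendsto_symm hpe
    filter_upwards [e.open_target.mem_nhds (e.map_source hpe), ht.eventually hcurve,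
      ht (hU.mem_nhds hf.mem)] with P h1 h2 h3 h4 h5
    obtain ⟨h6, h7⟩ := chart_symm_apply he h1
    exact hsing _ h3 (hΓ.subset (h2 (h6.trans h4) (h7.trans h5)))
  -- the limits of `A / α` and `B / α`
  obtain ⟨a, ha, hDAa⟩ := exists_tendsto_div hpe he hL hψ hα0 hf0 hAs
    (hz.mono fun P hP h1 h2 => (hP h1 h2).1)
  obtain ⟨b, hb, hDBb⟩ := exists_tendsto_div hpe he hL hψ hα0 hf0 hBs
    (hz.mono fun P hP h1 h2 => (hP h1 h2).2)
  rw [hDAa _ hB0, hDBb _ hA0] at hcomm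
  have hab : ¬(a = 0 ∧ b = 0) := by
    rintro ⟨rfl, rfl⟩
    linarith
  have hpos := sq_add_sq_pos hab
  set n := √(a ^ 2 + b ^ 2) with hn
  have hn0 : 0 < n := Real.sqrt_pos.2 hpos
  have hn2 : n ^ 2 = a ^ 2 + b ^ 2 := Real.sq_sqrt hpos.le
  set m : ℝ × ℝ := (b / n, -a / n) with hm
  have hαm : fderiv ℝ α p₀ (planarLift p₀ m) = -2 * fderiv ℝ f p₀ (frameT p₀) / n := by
    rw [← hcomm, planarLift_eq_frame, map_add, map_smul, map_smul]
    simp only [hm, smul_eq_mul]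
    ring
  have hlift : ∀ v, fderiv ℝ f p₀ (planarLift p₀ v) = 0 := fun v => by
    rw [fderiv_planarLift, hA0, hB0]
    ring
  set κ := fderiv ℝ α p₀ (planarLift p₀ m) / 2 with hκ
  have hκ0 : 0 < κ := by
    rw [hκ, hαm]
    exact half_pos (div_pos (by linarith) hn0)
  -- the direction field near `p₀` on the two sides
  have hlim : ∀ ρ : ℝ, ρ = 1 ∨ ρ = -1 →
      Tendsto (charDir f) (𝓝[S ∩ {q | 0 < ρ * α q}] p₀) (𝓝 (ρ • m)) := by
    intro ρ hρ
    have hset : 𝓝[S ∩ {q | 0 < ρ * α q}] p₀ ≤ 𝓝[{q | f q = 0 ∧ α q ≠ 0}] p₀ := by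
      refine le_inf nhdsWithin_le_nhds (le_principal_iff.2 ?_)
      filter_upwards [self_mem_nhdsWithin, mem_nhdsWithin_of_mem_nhds (hU.mem_nhds hf.mem)]
        with q hq hqU
      exact ⟨(hf.surface q hqU).1 hq.1, right_ne_zero_of_mul (ne_of_gt hq.2)⟩
    have ha' := ha.mono_left hset
    have hb' := hb.mono_left hset
    have hs := ((ha'.pow 2).add (hb'.pow 2)).sqrt
    have hw := ((hb'.div hs hn0.ne').prodMk_nhds (ha'.neg.div hs hn0.ne')).const_smul ρ
    refine hw.congr' ?_
    filter_upwards [self_mem_nhdsWithin] with q hq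
    have hq0 : 0 < ρ * α q := hq.2
    have hα : α q ≠ 0 := right_ne_zero_of_mul (ne_of_gt hq0)
    have hαρ : √((derivX f q / α q) ^ 2 + (derivY f q / α q) ^ 2) =
        √(derivX f q ^ 2 + derivY f q ^ 2) / (ρ * α q) := by
      have hρ2 : (ρ * α q) ^ 2 = α q ^ 2 := by
        rcases hρ with rfl | rfl <;> ring
      rw [← Real.sqrt_sq hq0.le, ← Real.sqrt_div' _ (sq_nonneg _), hρ2, div_pow, div_pow, add_div]
    have hρ0 : ρ ≠ 0 := left_ne_zero_of_mul (ne_of_gt hq0)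
    have hρ2 : ρ * ρ = 1 := by rcases hρ with rfl | rfl <;> norm_num
    have hcalc : ∀ x s : ℝ, ρ * (x / α q / (s / (ρ * α q))) = x / s := by
      intro x s
      rcases eq_or_ne s 0 with rfl | hs
      · simp
      · field_simp
        linear_combination x * hρ2
    change ρ • (derivY f q / α q / √((derivX f q / α q) ^ 2 + (derivY f q / α q) ^ 2),
      -(derivX f q / α q) / √((derivX f q / α q) ^ 2 + (derivY f q / α q) ^ 2)) = charDir f q
    rw [hαρ]
    simp only [charDir, Prod.smul_mk, smul_eq_mul, ← neg_div, hcalc]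
  have hrate : ∀ ρ : ℝ, ρ = 1 ∨ ρ = -1 → ∀ᶠ q in 𝓝 p₀, q ∈ S → 0 < ρ * α q →
      κ ≤ fderiv ℝ (fun q => ρ * α q) q (planarLift q (charDir f q)) := by
    intro ρ hρ
    have hρ2 : ρ * ρ = 1 := by rcases hρ with rfl | rfl <;> norm_num
    have h1 : Tendsto (fun q => planarLift q (charDir f q)) (𝓝[S ∩ {q | 0 < ρ * α q}] p₀)
        (𝓝 (planarLift p₀ (ρ • m))) :=
      ((contDiff_planarLift (n := 0)).continuous.tendsto (p₀, ρ • m)).comp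
        ((tendsto_id.mono_left nhdsWithin_le_nhds).prodMk_nhds (hlim ρ hρ))
    have h2 : Tendsto (fderiv ℝ α) (𝓝[S ∩ {q | 0 < ρ * α q}] p₀) (𝓝 (fderiv ℝ α p₀)) :=
      ((hα1 p₀ hf.mem).continuousAt_fderiv (by norm_num)).tendsto.mono_left nhdsWithin_le_nhds
    have h3 := ((isBoundedBilinearMap_apply (𝕜 := ℝ) (E := H1) (F := ℝ)).continuous.tendsto
      (fderiv ℝ α p₀, planarLift p₀ (ρ • m))).comp (h2.prodMk_nhds h1) |>.const_mul ρ
    have h4 : κ < ρ * fderiv ℝ α p₀ (planarLift p₀ (ρ • m)) := by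
      rw [planarLift_smul, map_smul, smul_eq_mul, ← mul_assoc, hρ2, one_mul]
      linarith
    have h5 := h3.eventually (lt_mem_nhds h4)
    rw [eventually_nhdsWithin_iff] at h5
    filter_upwards [h5, hU.mem_nhds hf.mem] with q hq hqU hqS hqα
    rw [fderiv_const_mul ((hα1 q hqU).differentiableAt (by norm_num))]
    exact (hq ⟨hqS, hqα⟩).le
  have hgood : {q | q ∈ U ∧ (α q = 0 → f q = 0 → q ∈ Γ) ∧ ∀ ρ : ℝ, ρ = 1 ∨ ρ = -1 → q ∈ S →
      0 < ρ * α q → κ ≤ fderiv ℝ (fun q => ρ * α q) q (planarLift q (charDir f q))} ∈ 𝓝 p₀ := by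
    filter_upwards [hU.mem_nhds hf.mem, hcurve, hrate 1 (Or.inl rfl), hrate (-1) (Or.inr rfl)]
      with q h1 h2 h3 h4
    refine ⟨h1, h2, ?_⟩
    rintro ρ (rfl | rfl)
    exacts [h3, h4]
  have hSf : ∀ V ⊆ U, ∀ ρ : ℝ, {q | q ∈ V ∧ f q = 0 ∧ 0 < ρ * α q} =
      {q | q ∈ V ∧ q ∈ S ∧ 0 < ρ * α q} := by
    intro V hV ρ
    ext q
    constructor
    · rintro ⟨h1, h2, h3⟩
      exact ⟨h1, (hf.surface q (hV h1)).2 h2, h3⟩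
    · rintro ⟨h1, h2, h3⟩
      exact ⟨h1, (hf.surface q (hV h1)).1 h2, h3⟩
  obtain ⟨R, hRgood, hRo, hpR, hRconn⟩ := exists_isPreconnected_side hpe he hgood
  refine ⟨α, m, κ, R, ?_, ?_, ?_, ?_, ?_⟩
  · intro ρ hρ
    have hreg : ∀ q ∈ R, 0 < ρ * α q → ¬(derivX f q = 0 ∧ derivY f q = 0) := fun q _ hq h0 => by
      rw [hαAB q h0, mul_zero] at hq
      exact lt_irrefl _ hq
    have hregS : ∀ q ∈ R, q ∈ S → 0 < ρ * α q → q ∈ regularPart S := fun q hq hqS hqα =>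
      ⟨hqS, fun hs => hreg q hq hqα (hsing q (hRgood hq).1 hs)⟩
    have hwc : ∀ q ∈ R, 0 < ρ * α q → ContDiffAt ℝ 1 (charDir f) q := fun q hq hqα =>
      contDiffAt_charDir (hA' q (hRgood hq).1) (hB' q (hRgood hq).1) (hreg q hq hqα)
    have hconn := hRconn ρ
    rw [hSf R (fun q hq => (hRgood hq).1)] at hconn
    have hunit : ∀ q ∈ regularPart S, e₁ q 0 ^ 2 + e₁ q 1 ^ 2 = 1 := by
      intro q hq
      have h1 := hS.field.unit q hq
      have h2 : contactForm q (e₁ q) = 0 := (hS.field.tangent q hq).2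
      simp only [adaptedMetric, frameCoord, h2, Fin.sum_univ_three] at h1
      simp at h1
      linear_combination h1
    have hlift1 : ∀ q ∈ regularPart S, planarLift q (e₁ q 0, e₁ q 1) = e₁ q := fun q hq =>
      planarLift_eq_of_mem_contactPlane (hS.field.tangent q hq).2
    -- `e₁` agrees with the direction field up to a sign, which is constant on the connected side
    have hsign : ∃ σ : ℝ, (σ = 1 ∨ σ = -1) ∧ ∀ q ∈ R, q ∈ S → 0 < ρ * α q →
        e₁ q 0 * (charDir f q).1 + e₁ q 1 * (charDir f q).2 = σ := by
      have hec : ContinuousOn e₁ {q | q ∈ R ∧ q ∈ S ∧ 0 < ρ * α q} := by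
        rintro q ⟨h1, h2, h3⟩
        obtain ⟨N, E, hN, hqN, hE, hEe⟩ := hS.field.smooth q (hregS q h1 h2 h3)
        have hE' : ContinuousAt E q := (hE.contDiffAt (hN.mem_nhds hqN)).continuousAt
        refine hE'.continuousWithinAt.congr_of_eventuallyEq ?_
          (hEe ⟨hregS q h1 h2 h3, hqN⟩).symm
        filter_upwards [self_mem_nhdsWithin, mem_nhdsWithin_of_mem_nhds (hN.mem_nhds hqN)]
          with x hx hxN using (hEe ⟨hregS x hx.1 hx.2.1 hx.2.2, hxN⟩).symm
      have hwc' : ContinuousOn (charDir f) {q | q ∈ R ∧ q ∈ S ∧ 0 < ρ * α q} :=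
        fun q hq => (hwc q hq.1 hq.2.2).continuousAt.continuousWithinAt
      have hgc : ContinuousOn (fun q => e₁ q 0 * (charDir f q).1 + e₁ q 1 * (charDir f q).2)
          {q | q ∈ R ∧ q ∈ S ∧ 0 < ρ * α q} :=
        (((continuous_apply 0).comp_continuousOn hec).mul (continuous_fst.comp_continuousOn hwc')).add
          (((continuous_apply 1).comp_continuousOn hec).mul (continuous_snd.comp_continuousOn hwc'))
      have hsq : EqOn ((fun q => e₁ q 0 * (charDir f q).1 + e₁ q 1 * (charDir f q).2) ^ 2) 1
          {q | q ∈ R ∧ q ∈ S ∧ 0 < ρ * α q} := by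
        rintro q ⟨h1, h2, h3⟩
        have hr := hregS q h1 h2 h3
        have htan := fderiv_eq_zero_of_mem_tangentPlane hU hf.surface (hRgood h1).1
          (hfd q (hRgood h1).1) (hS.field.tangent q hr).1
        rw [← hlift1 q hr, fderiv_planarLift] at htan
        exact inner_charDir_sq (hreg q h1 h3) (v := (e₁ q 0, e₁ q 1)) (hunit q hr) htan
      rcases hconn.eq_one_or_eq_neg_one_of_sq_eq hgc hsq with h | h
      · exact ⟨1, Or.inl rfl, fun q h1 h2 h3 => h ⟨h1, h2, h3⟩⟩
      · exact ⟨-1, Or.inr rfl, fun q h1 h2 h3 => h ⟨h1, h2, h3⟩⟩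
    obtain ⟨σ, hσ, hσe⟩ := hsign
    have hσ2 : σ * σ = 1 := by rcases hσ with rfl | rfl <;> norm_num
    refine ⟨σ, {
      isOpen := hRo
      base_mem := hpR
      surface := fun q hq => hf.surface q (hRgood hq).1
      differentiable_f := fun q hq => hfd q (hRgood hq).1
      differentiable_side := fun q hq =>
        ((hα1 q (hRgood hq).1).differentiableAt (by norm_num)).const_mul ρ
      base_singular := hp₀
      singular := fun q hq hs => by
        simp only [hαAB q (hsing q (hRgood hq).1 hs), mul_zero]
      curve := fun q hq hqS hq0 => by
        have hρ0 : ρ ≠ 0 := by rcases hρ with rfl | rfl <;> norm_num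
        exact (hRgood hq).2.1 ((mul_eq_zero.1 hq0).resolve_left hρ0)
          ((hf.surface q (hRgood hq).1).1 hqS)
      subset := hΓ.subset
      smooth := hwc
      unit := fun q hq hqα => charDir_unit (hreg q hq hqα)
      tangent := fun q _ _ => fderiv_charDir f q
      sign := hσ
      field := fun q hq hqS hqα => by
        have hr := hregS q hq hqS hqα
        rw [eq_smul_of_inner_eq hσ2 (charDir_unit (hreg q hq hqα)) (v := (e₁ q 0, e₁ q 1))
          (hunit q hr) (hσe q hq hqS hqα), planarLift_smul, hlift1 q hr]
      rate_pos := hκ0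
      rate := fun q hq hqS hqα => (hRgood hq).2.2 ρ hρ hqS hqα
      limit := hlim ρ hρ
      neBot := by
        have hne := neBot_side hpe he hα0 hf0 (ρ := ρ)
          (by rcases hρ with rfl | rfl <;> norm_num)
        refine hne.mono (le_inf nhdsWithin_le_nhds (le_principal_iff.2 ?_))
        filter_upwards [self_mem_nhdsWithin, mem_nhdsWithin_of_mem_nhds (hU.mem_nhds hf.mem)]
          with q hq hqU
        exact ⟨(hf.surface q hqU).2 hq.1, hq.2⟩ }⟩
  · intro V hV
    obtain ⟨V', hV', hV'o, hpV', hconn⟩ :=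
      exists_isPreconnected_side hpe he (inter_mem hV (hU.mem_nhds hf.mem))
    refine ⟨V', fun q hq => (hV' hq).1, hV'o.mem_nhds hpV', fun ρ => ?_⟩
    rw [← hSf V' (fun q hq => (hV' hq).2)]
    exact hconn ρ
  · simp only [hm]
    field_simp
    linear_combination -hn2
  · rw [hDAa _ (hlift _), hDBb _ (hlift _)]
    simp only [hm]
    field_simp
    ring
  · rw [hDAa _ (hlift _), hDBb _ (hlift _)]
    have : -m.2 * (fderiv ℝ α p₀ (planarLift p₀ m) * a)
        + m.1 * (fderiv ℝ α p₀ (planarLift p₀ m) * b) =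
        fderiv ℝ α p₀ (planarLift p₀ m) * n := by
      generalize fderiv ℝ α p₀ (planarLift p₀ m) = d
      simp only [hm]
      field_simp
      linear_combination -d * hn2
    rw [this]
    exact (mul_pos (by linarith) hn0).ne'

/-! ### Surfaces of class `C³` -/

theorem eq_zero_of_hasDerivAt_of_eventually_zero {g : ℝ → ℝ} {d : ℝ} (hg : HasDerivAt g d 0)
    (h0 : ∀ᶠ t in 𝓝[>] (0 : ℝ), g t = 0) : d = 0 := by
  have hg0 : g 0 = 0 := tendsto_nhds_unique_of_eventuallyEq
    (hg.continuousAt.tendsto.mono_left nhdsWithin_le_nhds) tendsto_const_nhds h0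
  have h1 : HasDerivWithinAt g 0 (Ioi 0) 0 :=
    (hasDerivWithinAt_const (0 : ℝ) (Ioi 0) (0 : ℝ)).congr_of_eventuallyEq h0 hg0
  exact (uniqueDiffWithinAt_Ioi 0).eq_deriv _ hg.hasDerivWithinAt h1

/-- The acceleration of a helix. -/
theorem hasDerivAt_helix_velocity {k : ℝ} (hk : k ≠ 0) (p : H1) (v : ℝ × ℝ) :
    HasDerivAt (fun t => planarLift (helix k p v t) (rot k v t))
      (k • planarLift p (-v.2, v.1)) 0 := by
  have h1 := hasDerivAt_rot_fst k v 0
  have h2 := hasDerivAt_rot_snd k v 0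
  have h3 := hasDerivAt_pi.1 (hasDerivAt_helix hk p v 0)
  refine hasDerivAt_pi.2 fun i => ?_
  fin_cases i
  · simpa [planarLift] using h1
  · simpa [planarLift] using h2
  · have := ((h3 1).mul h1).sub ((h3 0).mul h2)
    simp only [planarLift]
    refine this.congr_deriv ?_
    simp [planarLift]
    ring

/-- Let a helix start at a singular point and run in the surface `{f = 0}` for a short time. Then
the third derivative of `f` along it vanishes at that point. -/
theorem third_derivative_helix {n : WithTop ℕ∞} (hn : 3 ≤ n) {S U : Set H1} {p₀ : H1}
    {f : H1 → ℝ} (hf : IsOrientedPresentation n S p₀ U f) {k : ℝ} (hk : k ≠ 0) {v : ℝ × ℝ}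
    (h0 : ∀ᶠ t in 𝓝[>] (0 : ℝ), f (helix k p₀ v t) = 0) :
    2 * k * (-v.2 * fderiv ℝ (derivX f) p₀ (planarLift p₀ v)
        + v.1 * fderiv ℝ (derivY f) p₀ (planarLift p₀ v))
      + k * (v.1 * fderiv ℝ (derivX f) p₀ (planarLift p₀ (-v.2, v.1))
        + v.2 * fderiv ℝ (derivY f) p₀ (planarLift p₀ (-v.2, v.1)))
      + (v.1 * fderiv ℝ (fderiv ℝ (derivX f)) p₀ (planarLift p₀ v) (planarLift p₀ v)
        + v.2 * fderiv ℝ (fderiv ℝ (derivY f)) p₀ (planarLift p₀ v) (planarLift p₀ v)) = 0 := by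
  have hU := hf.isOpen
  have hn' : (2 : WithTop ℕ∞) + 1 ≤ n := by
    have : (2 : WithTop ℕ∞) + 1 = 3 := by norm_num
    rwa [this]
  have hfd : ∀ q ∈ U, DifferentiableAt ℝ f q := fun q hq =>
    (hf.contDiffOn.contDiffAt (hU.mem_nhds hq)).differentiableAt
      (by rintro rfl; norm_num at hn)
  obtain ⟨hA0, hB0⟩ := derivX_derivY_eq_zero_of_singular hU hf.surface hf.mem (hfd _ hf.mem)
    hf.singular
  have hG : ∀ t, HasDerivAt (helix k p₀ v) (planarLift (helix k p₀ v t) (rot k v t)) t :=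
    hasDerivAt_helix hk p₀ v
  have hUev : ∀ᶠ t in 𝓝 (0 : ℝ), helix k p₀ v t ∈ U :=
    (hG 0).continuousAt (hU.mem_nhds (by simpa using hf.mem))
  -- the first and the second derivative of a function along the helix
  have hfirst : ∀ g : H1 → ℝ, ∀ t, DifferentiableAt ℝ g (helix k p₀ v t) →
      HasDerivAt (fun t => g (helix k p₀ v t))
        (fderiv ℝ g (helix k p₀ v t) (planarLift (helix k p₀ v t) (rot k v t))) t :=
    fun g t hg => hg.hasFDerivAt.comp_hasDerivAt t (hG t)
  have hsecond : ∀ g : H1 → ℝ, ContDiffOn ℝ 2 g U →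
      HasDerivAt (fun t => fderiv ℝ g (helix k p₀ v t)
          (planarLift (helix k p₀ v t) (rot k v t)))
        (fderiv ℝ (fderiv ℝ g) p₀ (planarLift p₀ v) (planarLift p₀ v)
          + k * fderiv ℝ g p₀ (planarLift p₀ (-v.2, v.1))) 0 := by
    intro g hg
    have hd : DifferentiableAt ℝ (fderiv ℝ g) (helix k p₀ v 0) := by
      rw [helix_zero]
      exact ((hg.contDiffAt (hU.mem_nhds hf.mem)).fderiv_right (m := 1)
        (by norm_num)).differentiableAt (by norm_num)
    have := (hd.hasFDerivAt.comp_hasDerivAt (0 : ℝ) (hG 0)).clm_apply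
      (hasDerivAt_helix_velocity hk p₀ v)
    simpa using this
  have hA := hf.contDiffOn.derivX hU hn'
  have hB := hf.contDiffOn.derivY hU hn'
  have hd : ∀ g : H1 → ℝ, ContDiffOn ℝ 2 g U → ∀ q ∈ U, DifferentiableAt ℝ g q :=
    fun g hg q hq => (hg.contDiffAt (hU.mem_nhds hq)).differentiableAt (by norm_num)
  have hloc : ∀ P : ℝ → Prop, (∀ᶠ t in 𝓝[>] (0 : ℝ), P t) →
      ∀ᶠ t in 𝓝[>] (0 : ℝ), ∀ᶠ s in 𝓝 t, P s := fun P hP => by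
    rw [← eventually_eventually_nhdsWithin] at hP
    filter_upwards [hP, self_mem_nhdsWithin] with t ht ht0
    rwa [IsOpen.nhdsWithin_eq isOpen_Ioi ht0] at ht
  -- where a function vanishes to the right of `0`, so does its derivative
  have hzero : ∀ (g : ℝ → ℝ) (g' : ℝ → ℝ), (∀ᶠ t in 𝓝[>] (0 : ℝ), g t = 0) →
      (∀ᶠ t in 𝓝[>] (0 : ℝ), HasDerivAt g (g' t) t) → ∀ᶠ t in 𝓝[>] (0 : ℝ), g' t = 0 := by
    intro g g' hg hg'
    filter_upwards [hloc _ hg, hg'] with t ht ht'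
    exact ht'.unique ((hasDerivAt_const t (0 : ℝ)).congr_of_eventuallyEq ht)
  have hUev' := hUev.filter_mono (nhdsWithin_le_nhds (s := Ioi 0))
  have h1 := hzero _ _ h0 (by
    filter_upwards [hUev'] with t ht using hfirst f t (hfd _ ht))
  simp only [fderiv_planarLift f] at h1
  have hr1 := hasDerivAt_rot_fst k v
  have hr2 := hasDerivAt_rot_snd k v
  have h2 := hzero _ _ h1 (by
    filter_upwards [hUev'] with t ht
    exact ((hr1 t).mul (hfirst _ t (hd _ hA _ ht))).add ((hr2 t).mul (hfirst _ t (hd _ hB _ ht))))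
  have hp0 : helix k p₀ v 0 ∈ U := by simpa using hf.mem
  have h3 := eq_zero_of_hasDerivAt_of_eventually_zero
    (((((hr2 0).const_mul (-k)).mul (hfirst _ 0 (hd _ hA _ hp0))).add
      ((hr1 0).mul (hsecond _ hA))).add
    ((((hr1 0).const_mul k).mul (hfirst _ 0 (hd _ hB _ hp0))).add
      ((hr2 0).mul (hsecond _ hB)))) h2
  simp only [helix_zero, rot_zero, hA0, hB0] at h3
  linear_combination h3

/-- On a surface of class `C³`, two leaves cannot leave `p₀` in opposite directions with `e₁`
pointing away from `p₀` on both: their union would have the curvatures `k` and `-k` at `p₀`,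
but the third derivatives of `f` along them determine the curvature. -/
theorem IsTwoSidedModel.not_both_away {n : WithTop ℕ∞} (hn : 3 ≤ n) {S Γ U R : Set H1}
    {e₁ : H1 → H1} {f α : H1 → ℝ} {m : ℝ × ℝ} {κ : ℝ} {p₀ : H1}
    (h : IsTwoSidedModel S Γ e₁ f α m κ p₀ R) (hf : IsOrientedPresentation n S p₀ U f) {k : ℝ}
    (hk : k ≠ 0) (h1 : ∀ᶠ t in 𝓝[>] (0 : ℝ), f (helix k p₀ m t) = 0)
    (h2 : ∀ᶠ t in 𝓝[>] (0 : ℝ), f (helix k p₀ (-m) t) = 0) : False := by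
  have e1 := third_derivative_helix hn hf hk h1
  have e2 := third_derivative_helix hn hf hk h2
  have hJ : planarLift p₀ (-(-m).2, (-m).1) = -planarLift p₀ (-m.2, m.1) := by
    rw [← planarLift_neg]
    rfl
  rw [hJ, planarLift_neg] at e2
  simp only [map_neg, Prod.fst_neg, Prod.snd_neg, neg_neg, neg_apply] at e2
  have h3 := h.second_m
  refine h.second_Jm ((mul_eq_zero.1 ?_).resolve_left (mul_ne_zero four_ne_zero hk))
  linear_combination e1 + e2 - 2 * k * h3

/-! ### The leaves through a point of a singular curve -/

theorem contDiff_one_ite {E : Type*} [NormedAddCommGroup E] [NormedSpace ℝ E] {g₁ g₂ : ℝ → E}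
    (h₁ : ContDiff ℝ 1 g₁) (h₂ : ContDiff ℝ 1 g₂) (h0 : g₁ 0 = g₂ 0)
    (h0' : deriv g₁ 0 = deriv g₂ 0) :
    ContDiff ℝ 1 (fun t => if t ≤ 0 then g₁ t else g₂ t) := by
  have hd₁ : ∀ t, HasDerivAt g₁ (deriv g₁ t) t := fun t =>
    (h₁.differentiable (by norm_num) t).hasDerivAt
  have hd₂ : ∀ t, HasDerivAt g₂ (deriv g₂ t) t := fun t =>
    (h₂.differentiable (by norm_num) t).hasDerivAt
  have hd : ∀ t, HasDerivAt (fun t => if t ≤ 0 then g₁ t else g₂ t)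
      (if t ≤ 0 then deriv g₁ t else deriv g₂ t) t := by
    intro t
    rcases lt_trichotomy t 0 with ht | rfl | ht
    · rw [if_pos ht.le]
      refine (hd₁ t).congr_of_eventuallyEq ?_
      filter_upwards [gt_mem_nhds ht] with s hs using if_pos hs.le
    · rw [if_pos le_rfl]
      have hl : HasDerivWithinAt (fun t => if t ≤ 0 then g₁ t else g₂ t) (deriv g₁ 0) (Iic 0) 0 :=
        (hd₁ 0).hasDerivWithinAt.congr (fun s hs => if_pos hs) (if_pos le_rfl)
      have hr : HasDerivWithinAt (fun t => if t ≤ 0 then g₁ t else g₂ t) (deriv g₁ 0) (Ici 0) 0 := by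
        rw [h0']
        refine (hd₂ 0).hasDerivWithinAt.congr (fun s hs => ?_) (by simp [h0])
        rcases (show (0 : ℝ) ≤ s from hs).eq_or_lt with rfl | hs'
        · simp [h0]
        · exact if_neg hs'.not_ge
      have := hl.union hr
      rwa [Iic_union_Ici, hasDerivWithinAt_univ] at this
    · rw [if_neg ht.not_ge]
      refine (hd₂ t).congr_of_eventuallyEq ?_
      filter_upwards [lt_mem_nhds ht] with s hs using if_neg hs.not_ge
  rw [contDiff_one_iff_deriv]
  refine ⟨fun t => (hd t).differentiableAt, ?_⟩
  rw [show deriv (fun t => if t ≤ 0 then g₁ t else g₂ t) =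
    fun t => if t ≤ 0 then deriv g₁ t else deriv g₂ t from funext fun t => (hd t).deriv]
  exact (h₁.continuous_deriv le_rfl).if_le (h₂.continuous_deriv le_rfl) continuous_id
    continuous_const (by rintro t rfl; exact h0')

namespace IsTwoSidedModel

variable {S Γ R : Set H1} {e₁ : H1 → H1} {c : ℝ} {f α : H1 → ℝ} {m : ℝ × ℝ} {κ : ℝ} {p₀ : H1}

theorem exists_leaf_end (h : IsTwoSidedModel S Γ e₁ f α m κ p₀ R)
    (hS : IsConstantPMeanCurvatureSurface S e₁ c) (hc : c ≠ 0) :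
    ∃ U ∈ 𝓝 p₀, ∀ (I : Set ℝ) (γ : ℝ → H1), IsLeaf S e₁ I γ → (∃ t ∈ I, γ t ∈ U) →
      ∃ (b : ℝ) (p : H1), (IsLUB I b ∨ IsGLB I b) ∧ p ∈ Γ ∧
        ContDiffOn ℝ ∞ (Function.update γ b p) (insert b I) := by
  obtain ⟨σ₁, h₁⟩ := h.side 1 (Or.inl rfl)
  obtain ⟨σ₂, h₂⟩ := h.side (-1) (Or.inr rfl)
  obtain ⟨U₁, hU₁, H₁⟩ := h₁.exists_leaf_end hS hc
  obtain ⟨U₂, hU₂, H₂⟩ := h₂.exists_leaf_end hS hc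
  refine ⟨U₁ ∩ U₂ ∩ R, inter_mem (inter_mem hU₁ hU₂) (h₁.isOpen.mem_nhds h₁.base_mem), ?_⟩
  rintro I γ hγ ⟨t, ht, htU⟩
  have hne : 1 * α (γ t) ≠ 0 := h₁.side_ne_zero htU.2 (hγ.curve t ht).1
  rcases hne.lt_or_gt with hlt | hgt
  · exact H₂ I γ hγ ⟨t, ht, htU.1.2, by linarith⟩
  · exact H₁ I γ hγ ⟨t, ht, htU.1.1, hgt⟩

theorem exists_arcs (h : IsTwoSidedModel S Γ e₁ f α m κ p₀ R)
    (hS : IsConstantPMeanCurvatureSurface S e₁ c) (hc : c ≠ 0) :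
    ∃ (σ₁ σ₂ ε₁ ε₂ : ℝ) (γ₁ γ₂ : ℝ → H1),
      IsLeafArc S e₁ p₀ σ₁ ε₁ γ₁ ∧ IsLeafArc S e₁ p₀ σ₂ ε₂ γ₂ ∧
        OnOppositeSides S Γ p₀ γ₁ γ₂ := by
  obtain ⟨σ₁, h₁⟩ := h.side 1 (Or.inl rfl)
  obtain ⟨σ₂, h₂⟩ := h.side (-1) (Or.inr rfl)
  obtain ⟨T₁, hT₁, harc₁, hα₁⟩ := h₁.exists_isLeafArc hS hc
  obtain ⟨T₂, hT₂, harc₂, hα₂⟩ := h₂.exists_isLeafArc hS hc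
  refine ⟨σ₁, σ₂, T₁, T₂, _, _, harc₁, harc₂, R, h₁.isOpen.mem_nhds h₁.base_mem, ?_⟩
  filter_upwards [Ioo_mem_nhdsGT hT₁, Ioo_mem_nhdsGT hT₂] with t ht₁ ht₂ heq
  obtain ⟨hR₁, hpos₁⟩ := hα₁ t ht₁
  obtain ⟨hR₂, hpos₂⟩ := hα₂ t ht₂
  have hΓ : ∀ q ∈ R, q ∈ regularPart S → q ∈ (S ∩ R) \ Γ := fun q hq hreg =>
    ⟨⟨hreg.1, hq⟩, fun hqΓ => hreg.2 (h₁.subset hqΓ)⟩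
  have hm₁ := mem_connectedComponentIn (hΓ _ hR₁ (harc₁.regular t ht₁))
  have hm₂ := mem_connectedComponentIn (hΓ _ hR₂ (harc₂.regular t ht₂))
  rw [← heq] at hm₂
  -- a connected set that meets both sides contains a zero of `α`
  have hcont : ContinuousOn (fun q => 1 * α q)
      (connectedComponentIn ((S ∩ R) \ Γ) (helix (σ₁ * c) p₀ ((1 : ℝ) • m) t)) := fun q hq =>
    (h₁.differentiable_side q
      (connectedComponentIn_subset _ _ hq).1.2).continuousAt.continuousWithinAt
  obtain ⟨q, hq, hq0⟩ := isPreconnected_connectedComponentIn.intermediate_value hm₂ hm₁ hcont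
    (show (0 : ℝ) ∈ Icc _ _ from ⟨by linarith, hpos₁.le⟩)
  have hq' := connectedComponentIn_subset _ _ hq
  exact hq'.2 (h₁.curve q hq'.1.2 hq'.1.1 hq0)

theorem arc_side (h : IsTwoSidedModel S Γ e₁ f α m κ p₀ R) {σ ε : ℝ} {γ : ℝ → H1}
    (hγ : IsLeafArc S e₁ p₀ σ ε γ) :
    ∃ ρ : ℝ, (ρ = 1 ∨ ρ = -1) ∧ ∀ᶠ t in 𝓝[>] (0 : ℝ), 0 < ρ * α (γ t) := by
  obtain ⟨σ₁, h₁⟩ := h.side 1 (Or.inl rfl)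
  have hev : ∀ᶠ t in 𝓝[>] (0 : ℝ), γ t ∈ R ∧ t ∈ Ioo 0 ε := by
    filter_upwards [hγ.tendsto_start (h₁.isOpen.mem_nhds h₁.base_mem), Ioo_mem_nhdsGT hγ.pos]
      with t ht1 ht2 using ⟨ht1, ht2⟩
  obtain ⟨δ, hδ, hball⟩ := mem_nhdsGT_iff_exists_Ioo_subset.1 hev
  have hcont : ContinuousOn (fun t => α (γ t)) (Ioo 0 δ) := fun t ht => by
    have h2 := (h₁.differentiable_side _ (hball ht).1).continuousAt
    simp only [one_mul] at h2
    exact (ContinuousAt.comp (f := γ) (g := α) h2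
      (hγ.deriv t (hball ht).2).continuousAt).continuousWithinAt
  have hne : ∀ t ∈ Ioo 0 δ, α (γ t) ≠ 0 := fun t ht h0 =>
    h₁.side_ne_zero (hball ht).1 (hγ.regular t (hball ht).2) (by simp [h0])
  have hδ0 : (0 : ℝ) < δ := hδ
  have hmid : δ / 2 ∈ Ioo 0 δ := ⟨by linarith, by linarith⟩
  rcases (hne _ hmid).lt_or_gt with hlt | hgt
  · refine ⟨-1, Or.inr rfl, ?_⟩
    filter_upwards [Ioo_mem_nhdsGT hδ0] with t ht
    by_contra hneg
    obtain ⟨s, hs, hs0⟩ := isPreconnected_Ioo.intermediate_value hmid ht hcont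
      (show (0 : ℝ) ∈ Icc _ _ from ⟨hlt.le, by linarith⟩)
    exact hne s hs hs0
  · refine ⟨1, Or.inl rfl, ?_⟩
    filter_upwards [Ioo_mem_nhdsGT hδ0] with t ht
    by_contra hneg
    obtain ⟨s, hs, hs0⟩ := isPreconnected_Ioo.intermediate_value ht hmid hcont
      (show (0 : ℝ) ∈ Icc _ _ from ⟨by linarith, hgt.le⟩)
    exact hne s hs hs0

/-- Two leaf arcs on opposite sides leave `p₀` in opposite directions. -/
theorem arcs_eq_helix (h : IsTwoSidedModel S Γ e₁ f α m κ p₀ R)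
    (hS : IsConstantPMeanCurvatureSurface S e₁ c) (hc : c ≠ 0) {σ₁ σ₂ ε₁ ε₂ : ℝ}
    {γ₁ γ₂ : ℝ → H1} (hγ₁ : IsLeafArc S e₁ p₀ σ₁ ε₁ γ₁) (hγ₂ : IsLeafArc S e₁ p₀ σ₂ ε₂ γ₂)
    (hopp : OnOppositeSides S Γ p₀ γ₁ γ₂) :
    ∃ v : ℝ × ℝ, (v = m ∨ v = -m) ∧ (∀ t ∈ Ico 0 ε₁, γ₁ t = helix (σ₁ * c) p₀ (-v) t) ∧
      ∀ t ∈ Ico 0 ε₂, γ₂ t = helix (σ₂ * c) p₀ v t := by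
  obtain ⟨ρ₁, hρ₁, hα₁⟩ := h.arc_side hγ₁
  obtain ⟨ρ₂, hρ₂, hα₂⟩ := h.arc_side hγ₂
  obtain ⟨τ₁, h₁⟩ := h.side ρ₁ hρ₁
  obtain ⟨τ₂, h₂⟩ := h.side ρ₂ hρ₂
  obtain ⟨rfl, hG₁⟩ := h₁.eq_helix_of_isLeafArc hS hc hγ₁ hα₁
  obtain ⟨rfl, hG₂⟩ := h₂.eq_helix_of_isLeafArc hS hc hγ₂ hα₂
  have hρ : ρ₁ = -ρ₂ := by
    by_contra hne
    have heq : ρ₁ = ρ₂ := by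
      rcases hρ₁ with rfl | rfl <;> rcases hρ₂ with rfl | rfl <;> simp at hne ⊢
    subst heq
    -- arcs on the same side run in the same connected set
    obtain ⟨U, hU, hcomp⟩ := hopp
    obtain ⟨V, hVU, hV, hconn⟩ :=
      h.connected (U ∩ R) (inter_mem hU (h₁.isOpen.mem_nhds h₁.base_mem))
    have hsub : {q | q ∈ V ∧ q ∈ S ∧ 0 < ρ₁ * α q} ⊆ (S ∩ U) \ Γ := by
      rintro q ⟨hq1, hq2, hq3⟩
      exact ⟨⟨hq2, (hVU hq1).1⟩, fun hqΓ =>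
        hq3.ne' (h₁.singular q (hVU hq1).2 (h₁.subset hqΓ))⟩
    have hev : ∀ (σ ε : ℝ) (γ : ℝ → H1), IsLeafArc S e₁ p₀ σ ε γ →
        (∀ᶠ t in 𝓝[>] (0 : ℝ), 0 < ρ₁ * α (γ t)) →
        ∀ᶠ t in 𝓝[>] (0 : ℝ), γ t ∈ {q | q ∈ V ∧ q ∈ S ∧ 0 < ρ₁ * α q} := by
      intro σ ε γ hγ hα
      filter_upwards [hα, hγ.tendsto_start hV, Ioo_mem_nhdsGT hγ.pos] with t ht1 ht2 ht3
      exact ⟨ht2, (hγ.regular t ht3).1, ht1⟩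
    obtain ⟨t, ht, ht₁, ht₂⟩ :=
      (hcomp.and ((hev _ _ _ hγ₁ hα₁).and (hev _ _ _ hγ₂ hα₂))).exists
    exact ht (connectedComponentIn_eq ((hconn ρ₁).subset_connectedComponentIn ht₁ hsub ht₂))
  refine ⟨ρ₂ • m, ?_, fun t ht => ?_, hG₂⟩
  · rcases hρ₂ with rfl | rfl <;> simp
  · rw [hG₁ t ht, hρ, neg_smul]

end IsTwoSidedModel

/-- The union of two helices with opposite initial velocities is a helix up to time `0` and a helix
with the same velocity from then on. -/
theorem joinArcs_eq_of_helix {k₁ k₂ ε₁ ε₂ : ℝ} {p : H1} {v : ℝ × ℝ} {γ₁ γ₂ : ℝ → H1}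
    (h₁ : ∀ t ∈ Ico 0 ε₁, γ₁ t = helix k₁ p (-v) t) (h₂ : ∀ t ∈ Ico 0 ε₂, γ₂ t = helix k₂ p v t)
    {t : ℝ} (ht : t ∈ Ioo (-ε₁) ε₂) :
    joinArcs γ₁ γ₂ t = if t ≤ 0 then helix (-k₁) p v t else helix k₂ p v t := by
  unfold joinArcs
  split_ifs with h
  · rw [h₁ (-t) ⟨by linarith, by linarith [ht.1]⟩, helix_neg_neg]
  · exact h₂ t ⟨by linarith, ht.2⟩

theorem mainTheorem5 (S : Set H1) (e₁ : H1 → H1) (c : ℝ) (hc : c ≠ 0)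
    (hS : IsConstantPMeanCurvatureSurface S e₁ c)
    (Γ : Set H1) (hΓ : IsSingularCurve S Γ) (p₀ : H1) (hp₀ : p₀ ∈ Γ) :
    -- near the singular curve, every leaf extends smoothly to a point of the singular curve
    (∃ U ∈ 𝓝 p₀, ∀ (I : Set ℝ) (γ : ℝ → H1), IsLeaf S e₁ I γ → (∃ t ∈ I, γ t ∈ U) →
      ∃ (b : ℝ) (p : H1), (IsLUB I b ∨ IsGLB I b) ∧ p ∈ Γ ∧
        ContDiffOn ℝ ∞ (Function.update γ b p) (insert b I)) ∧
    -- leaves arrive at `p₀` from both sides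
    (∃ (σ₁ σ₂ ε₁ ε₂ : ℝ) (γ₁ γ₂ : ℝ → H1),
      IsLeafArc S e₁ p₀ σ₁ ε₁ γ₁ ∧ IsLeafArc S e₁ p₀ σ₂ ε₂ γ₂ ∧
        OnOppositeSides S Γ p₀ γ₁ γ₂) ∧
    -- the leaves from the two sides join into a regular curve of class `C¹`, which is smooth if
    -- `e₁` is directed consistently along it, or if the surface is of class `C³` near `p₀`
    (∀ (σ₁ σ₂ ε₁ ε₂ : ℝ) (γ₁ γ₂ : ℝ → H1),
      IsLeafArc S e₁ p₀ σ₁ ε₁ γ₁ → IsLeafArc S e₁ p₀ σ₂ ε₂ γ₂ →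
        OnOppositeSides S Γ p₀ γ₁ γ₂ →
        ContDiffOn ℝ 1 (joinArcs γ₁ γ₂) (Ioo (-ε₁) ε₂) ∧
        deriv (joinArcs γ₁ γ₂) 0 ≠ 0 ∧
        (σ₁ = -σ₂ ∨ IsSurfaceAt 3 S p₀ →
          ContDiffOn ℝ ∞ (joinArcs γ₁ γ₂) (Ioo (-ε₁) ε₂))) := by
  have hsing := hΓ.subset hp₀
  obtain ⟨U, f, hf⟩ := exists_orientedPresentation (by norm_num) (hS.surface.c2 p₀ hsing.1) hsing
  obtain ⟨α, m, κ, R, h⟩ := exists_twoSidedModel hS hΓ hp₀ hf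
  refine ⟨h.exists_leaf_end hS hc, h.exists_arcs hS hc, ?_⟩
  intro σ₁ σ₂ ε₁ ε₂ γ₁ γ₂ hγ₁ hγ₂ hopp
  have hσ₁ : σ₁ ≠ 0 := by rcases hγ₁.sign with h | h <;> rw [h] <;> norm_num
  have hσ₂ : σ₂ ≠ 0 := by rcases hγ₂.sign with h | h <;> rw [h] <;> norm_num
  obtain ⟨v, hv, hG₁, hG₂⟩ := h.arcs_eq_helix hS hc hγ₁ hγ₂ hopp
  have hvm : v.1 ^ 2 + v.2 ^ 2 = 1 := by
    have := h.unit
    rcases hv with rfl | rfl <;> simpa using this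
  have hjoin : EqOn (joinArcs γ₁ γ₂)
      (fun t => if t ≤ 0 then helix (-(σ₁ * c)) p₀ v t else helix (σ₂ * c) p₀ v t)
      (Ioo (-ε₁) ε₂) := fun t ht => joinArcs_eq_of_helix hG₁ hG₂ ht
  have h0 : (0 : ℝ) ∈ Ioo (-ε₁) ε₂ := ⟨by linarith [hγ₁.pos], hγ₂.pos⟩
  have hd₁ := hasDerivAt_helix (neg_ne_zero.2 (mul_ne_zero hσ₁ hc)) p₀ v 0
  have hd₂ := hasDerivAt_helix (mul_ne_zero hσ₂ hc) p₀ v 0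
  rw [helix_zero, rot_zero] at hd₁ hd₂
  have hC1 : ContDiffOn ℝ 1 (joinArcs γ₁ γ₂) (Ioo (-ε₁) ε₂) :=
    (contDiff_one_ite (contDiff_helix _ _ _) (contDiff_helix _ _ _) (by simp)
      (by rw [hd₁.deriv, hd₂.deriv])).contDiffOn.congr hjoin
  have hsmooth : σ₁ = -σ₂ → ContDiffOn ℝ ∞ (joinArcs γ₁ γ₂) (Ioo (-ε₁) ε₂) := by
    intro hσ
    refine (contDiff_helix (σ₂ * c) p₀ v).contDiffOn.congr fun t ht => ?_
    rw [hjoin ht, hσ, neg_mul, neg_neg]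
    exact ite_self _
  refine ⟨hC1, ?_, ?_⟩
  · have hd : HasDerivAt (joinArcs γ₁ γ₂) (deriv (joinArcs γ₁ γ₂) 0) 0 :=
      ((hC1.contDiffAt (isOpen_Ioo.mem_nhds h0)).differentiableAt (by norm_num)).hasDerivAt
    -- the derivative is computed from the right
    have hr : HasDerivWithinAt (joinArcs γ₁ γ₂) (planarLift p₀ v) (Ioi 0) 0 := by
      refine hd₂.hasDerivWithinAt.congr_of_eventuallyEq ?_ ?_
      · filter_upwards [Ioo_mem_nhdsGT hγ₂.pos] with t ht
        rw [hjoin ⟨h0.1.trans ht.1, ht.2⟩]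
        exact if_neg ht.1.not_ge
      · simp [hjoin h0]
    rw [(uniqueDiffWithinAt_Ioi 0).eq_deriv _ hd.hasDerivWithinAt hr]
    intro hzero
    have e1 : v.1 = 0 := by simpa [planarLift] using congrFun hzero 0
    have e2 : v.2 = 0 := by simpa [planarLift] using congrFun hzero 1
    rw [e1, e2] at hvm
    norm_num at hvm
  · rintro (hσ | h3)
    · exact hsmooth hσ
    · refine hsmooth (by_contra fun hne => ?_)
      have hσ : σ₁ = σ₂ := by
        rcases hγ₁.sign with h1 | h1 <;> rcases hγ₂.sign with h2 | h2 <;>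
          simp [h1, h2] at hne ⊢
      subst hσ
      -- the presentation of class `C³` need not be the one used above
      obtain ⟨U₃, f₃, hf₃⟩ := exists_orientedPresentation (by norm_num) h3 hsing
      have hf₃' : IsOrientedPresentation 2 S p₀ U₃ f₃ :=
        { hf₃ with contDiffOn := hf₃.contDiffOn.of_le (by norm_num) }
      obtain ⟨α₃, m₃, κ₃, R₃, h₃⟩ := exists_twoSidedModel hS hΓ hp₀ hf₃'
      obtain ⟨u, hu, hu₁, hu₂⟩ := h₃.arcs_eq_helix hS hc hγ₁ hγ₂ hopp
      have hvan : ∀ (ε : ℝ) (γ : ℝ → H1) (x : ℝ × ℝ), IsLeafArc S e₁ p₀ σ₁ ε γ →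
          (∀ t ∈ Ico 0 ε, γ t = helix (σ₁ * c) p₀ x t) →
          ∀ᶠ t in 𝓝[>] (0 : ℝ), f₃ (helix (σ₁ * c) p₀ x t) = 0 := by
        intro ε γ x hγ hx
        have hlim : Tendsto (helix (σ₁ * c) p₀ x) (𝓝[>] 0) (𝓝 p₀) := by
          simpa using (((contDiff_helix (n := 0) (σ₁ * c) p₀ x).continuous).tendsto 0).mono_left
            nhdsWithin_le_nhds
        filter_upwards [Ioo_mem_nhdsGT hγ.pos, hlim (hf₃.isOpen.mem_nhds hf₃.mem)] with t ht ht'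
        refine (hf₃.surface _ ht').1 ?_
        rw [← hx t (Ioo_subset_Ico_self ht)]
        exact (hγ.regular t ht).1
      have e1 := hvan _ _ _ hγ₁ hu₁
      have e2 := hvan _ _ _ hγ₂ hu₂
      rcases hu with rfl | rfl
      · exact h₃.not_both_away le_rfl hf₃ (mul_ne_zero hσ₁ hc) e2 e1
      · rw [neg_neg] at e1
        exact h₃.not_both_away le_rfl hf₃ (mul_ne_zero hσ₁ hc) e1 e2
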